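/- Let $n\ge 1$. The alphabet is $[\overline n]=\{1<2<\dots<n<\overline n<\overline{n-1}<\dots<\overline 1\}$, with the involution $x\mapsto\overline x$ and with $|i|=|\overline{\imath}|=i$ for $1\le i\le n$. For $a\in[\overline n]$, $\prec_a$ denotes the circular order on $[\overline n]$ starting at $a$ (go around the circle $1,2,\dots,n,\overline n,\dots,\overline 1$ in increasing direction, beginning at $a$). Let $B_n$ be the group (under composition) of bijections $w:[\overline n]\to[\overline n]$ with $w(\overline x)=\overline{w(x)}$, and let $\ell(w)=\#\{(p,q)\in[n]\times[\overline n]: p\le|q|,\ w(p)>w(q)\}$. For $1\le i<j\le n$, write $(i,j)$ for the root $\varepsilon_i-\varepsilon_j$ and its reflection $t_{ij}t_{\overline{\jmath}\,\overline{\imath}}$, and $(i,\overline{\jmath})$ for the root $\varepsilon_i+\varepsilon_j$ and its reflection $t_{i\overline{\jmath}}t_{j\overline{\imath}}$; for $1\le i\le n$, write $(i,\overline{\imath})$ for the root $2\varepsilon_i$ and its reflection $t_{i\overline{\imath}}$. Here $t_{xy}$ is the transposition of $x$ and $y$; these roots are the positive roots of type $C_n$. Let $\rho=(n,n-1,\dots,1)$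 and $\langle\rho,\alpha^\vee\rangle=2(\rho,\alpha)/(\alpha,\alpha)$. The quantum Bruhat graph on $B_n$ has an edge $w\to ws_\alpha$ labeled by the positive root $\alpha$ whenever $\ell(ws_\alpha)=\ell(w)+1$ or $\ell(ws_\alpha)=\ell(w)-2\langle\rho,\alpha^\vee\rangle+1$. For $1\le k\le n$ let $\Gamma_l(k)=\Gamma_{k1}\Gamma_{k2}\cdots\Gamma_{kk}$ (concatenation), where $$\Gamma_{ki}=\big((1,\overline{\imath}),\dots,(i-1,\overline{\imath}),\ (i,\overline{k+1}),\dots,(i,\overline n),\ (i,\overline{\imath}),\ (i,n),(i,n-1),\dots,(i,k+1)\big),$$ and let $\mathrm{rev}(\Gamma_l(k))$ be the reversed sequence. A column of height $k$ is a sequence $C'=(C'(1),\dots,C'(k))$ of elements of $[\overline n]$ with pairwise distinct absolute values, in any order. For $w\in B_n$ let $w[1,k]=(w(1),\dots,w(k))$. Let $1\le k\le n$, let $u\in B_n$, let $C=u[1,k]$, and let $C'$ be a column of height $k$. Then the following hold. (1) There are a $v\in B_n$ with $v[1,k]=C'$ and a path $u=u_0,u_1,\dots,u_p=v$ in the quantum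 Bruhat graph whose sequence of edge labels is a subsequence of $\mathrm{rev}(\Gamma_l(k))$ if and only if the pair $C'C$ satisfies the following condition: for all $1\le i<l\le k$, neither $C(i)=C'(l)$ nor $C(i)\prec C'(l)\prec C'(i)$ holds, where $\prec$ is $\prec_{C(i)}$. (2) There is at most one such path: its endpoint $v$, its vertices and its edge labels are all uniquely determined by $u$ and $C'$. (3) For such a path and every $i=1,\dots,k$, $$C(i)=u_0(i)\preceq u_1(i)\preceq\cdots\preceq u_p(i)=C'(i),$$ where $\preceq$ is the weak version of $\prec_{C(i)}$. -/

import Mathlib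

namespace TypeC

/-- The alphabet `1 < 2 < ⋯ < n < n̄ < ⋯ < 2̄ < 1̄` with its linear order. The letter `i` is the
element `i - 1` of `Fin (2 * n)`, and `ī` is its mirror image `2 * n - i`. -/
abbrev Letter (n : ℕ) : Type := Fin (2 * n)

/-- The barring involution `x ↦ x̄`. -/
def bar {n : ℕ} (x : Letter n) : Letter n := Fin.rev x

/-- The unbarred letter with (zero-based) index `i`. -/
def unbarred {n : ℕ} (i : Fin n) : Letter n := ⟨i.val, by omega⟩

/-- The absolute value of a letter, as a zero-based index: both `i` and `ī` have index `i - 1`. -/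
def absIndex {n : ℕ} (x : Letter n) : Fin n :=
  ⟨min x.val (bar x).val, by
    have h := x.isLt
    simp only [bar, Fin.val_rev]
    omega⟩

/-- The hyperoctahedral group `B_n`: bijections `w` of the alphabet with `w(x̄) = \overline{w(x)}`.
The product is composition. -/
def signedPerm (n : ℕ) : Subgroup (Equiv.Perm (Letter n)) where
  carrier := {w | ∀ x, w (bar x) = bar (w x)}
  one_mem' := fun _ => rfl
  mul_mem' := by
    intro a b ha hb x
    simp only [Set.mem_ofPred_eq] at ha hb
    simp only [Equiv.Perm.mul_apply, hb, ha]
  inv_mem' := by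
    intro a ha x
    simp only [Set.mem_ofPred_eq] at ha
    rw [Equiv.Perm.inv_eq_iff_eq, ha]
    simp

/-- The length of `w`: the number of pairs of positions `(k, l) ∈ [n] × [n̄]` with `k ≤ |l|` and
`w(k) > w(l)`. -/
def length {n : ℕ} (w : signedPerm n) : ℕ :=
  (Finset.univ.filter fun p : Fin n × Letter n =>
    p.1 ≤ absIndex p.2 ∧ w.val p.2 < w.val (unbarred p.1)).card

/-- The positive roots of type `C_n`. -/
inductive PosRoot (n : ℕ) : Type
  /-- `(i, j)`, that is `ε_i - ε_j`, for `i < j` -/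
  | sub (i j : Fin n) (h : i < j) : PosRoot n
  /-- `(i, j̄)`, that is `ε_i + ε_j`, for `i < j` -/
  | add (i j : Fin n) (h : i < j) : PosRoot n
  /-- `(i, ī)`, that is `2 ε_i` -/
  | dbl (i : Fin n) : PosRoot n

namespace PosRoot

/-- The coordinates of a root in the basis `ε_1, …, ε_n`. -/
def toVec {n : ℕ} : PosRoot n → Fin n → ℚ
  | sub i j _ => Pi.single i 1 - Pi.single j 1
  | add i j _ => Pi.single i 1 + Pi.single j 1
  | dbl i => Pi.single i 2

/-- The underlying permutation of the alphabet of the reflection in a root. -/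
def reflPerm {n : ℕ} : PosRoot n → Equiv.Perm (Letter n)
  | sub i j _ =>
    Equiv.swap (unbarred i) (unbarred j) * Equiv.swap (bar (unbarred j)) (bar (unbarred i))
  | add i j _ =>
    Equiv.swap (unbarred i) (bar (unbarred j)) * Equiv.swap (unbarred j) (bar (unbarred i))
  | dbl i => Equiv.swap (unbarred i) (bar (unbarred i))

theorem reflPerm_mem {n : ℕ} (α : PosRoot n) : α.reflPerm ∈ signedPerm n := by
  intro x
  cases α with
  | sub i j h =>
    simp only [reflPerm, Equiv.Perm.mul_apply, Equiv.swap_apply_def, unbarred, bar, Fin.ext_iff,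
      Fin.val_rev, Fin.lt_def] at h ⊢
    grind
  | add i j h =>
    simp only [reflPerm, Equiv.Perm.mul_apply, Equiv.swap_apply_def, unbarred, bar, Fin.ext_iff,
      Fin.val_rev, Fin.lt_def] at h ⊢
    grind
  | dbl i =>
    simp only [reflPerm, Equiv.swap_apply_def, unbarred, bar, Fin.ext_iff, Fin.val_rev]
    grind

/-- The reflection `s_α`, as a signed permutation. -/
def refl {n : ℕ} (α : PosRoot n) : signedPerm n := ⟨α.reflPerm, α.reflPerm_mem⟩

end PosRoot

/-- The vector `ρ = (n, n - 1, …, 1)`. -/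
def rho (n : ℕ) (i : Fin n) : ℚ := (n : ℚ) - (i.val : ℚ)

/-- `⟨x, α^∨⟩ = 2 (x, α) / (α, α)`. -/
def corootPairing {n : ℕ} (x : Fin n → ℚ) (α : PosRoot n) : ℚ :=
  2 * (∑ i, x i * α.toVec i) / (∑ i, α.toVec i * α.toVec i)

/-- `QBEdge w α w'`: the quantum Bruhat graph has an edge `w → w'` labelled `α`, that is,
`w' = w s_α` and either `ℓ(w s_α) = ℓ(w) + 1` (Bruhat edge) or
`ℓ(w s_α) = ℓ(w) - 2⟨ρ, α^∨⟩ + 1` (quantum edge). -/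
def QBEdge {n : ℕ} (w : signedPerm n) (α : PosRoot n) (w' : signedPerm n) : Prop :=
  w' = w * α.refl ∧
    (length w' = length w + 1 ∨
      (length w' : ℚ) = (length w : ℚ) - 2 * corootPairing (rho n) α + 1)

/-- `IsQBPath u S v`: the list of labelled steps `S = [(α₁, u₁), …, (α_p, u_p)]` is a path
`u = u₀ → u₁ → ⋯ → u_p = v` in the quantum Bruhat graph, where the edge `u_{j-1} → u_j` is
labelled `α_j`. -/
def IsQBPath {n : ℕ} : signedPerm n → List (PosRoot n × signedPerm n) → signedPerm n → Prop
  | u, [], v => u = v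
  | u, (α, w) :: S, v => QBEdge u α w ∧ IsQBPath w S v

/-- The edge labels `α₁, …, α_p` of a path. -/
def pathLabels {n : ℕ} (S : List (PosRoot n × signedPerm n)) : List (PosRoot n) :=
  S.map Prod.fst

/-- The vertices `u₀, u₁, …, u_p` of a path starting at `u`. -/
def pathVertices {n : ℕ} (u : signedPerm n) (S : List (PosRoot n × signedPerm n)) :
    List (signedPerm n) :=
  u :: S.map Prod.snd

/-- The segment `Γ_{ki}`:
`(1, ī), …, (i-1, ī), (i, \overline{k+1}), …, (i, n̄), (i, ī), (i, n), (i, n-1), …, (i, k+1)`. -/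
def gammaSegment {n k : ℕ} (hk : k ≤ n) (i : Fin k) : List (PosRoot n) :=
  ((List.finRange n).filterMap fun a =>
      if h : a < Fin.castLE hk i then some (.add a (Fin.castLE hk i) h) else none) ++
  ((List.finRange n).filterMap fun m =>
      if h : k ≤ m.val then
        some (.add (Fin.castLE hk i) m (Fin.lt_def.2 (lt_of_lt_of_le i.isLt h)))
      else none) ++
  [.dbl (Fin.castLE hk i)] ++
  ((List.finRange n).reverse.filterMap fun m =>
      if h : k ≤ m.val then
        some (.sub (Fin.castLE hk i) m (Fin.lt_def.2 (lt_of_lt_of_le i.isLt h)))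
      else none)

/-- The chain of roots `Γ_l(k) = Γ_{k1} Γ_{k2} ⋯ Γ_{kk}`. -/
def gammaL {n k : ℕ} (hk : k ≤ n) : List (PosRoot n) :=
  (List.finRange k).flatMap fun i => gammaSegment hk i

/-- The strict circular order `x ≺_a y` on the alphabet starting at `a`. The subtraction is
modulo `2 * n`, so `x - a` is the number of steps needed to reach `x` from `a` when going around
the circle `1, …, n, n̄, …, 1̄` in the increasing direction. -/
def CircLT {n : ℕ} (a x y : Letter n) : Prop := x - a < y - a

/-- The weak circular order `x ⪯_a y` on the alphabet starting at `a`. -/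
def CircLE {n : ℕ} (a x y : Letter n) : Prop := x - a ≤ y - a

/-- A column of height `k`: a filling with letters of pairwise distinct absolute values, in any
order. -/
def IsColumn {n k : ℕ} (C : Fin k → Letter n) : Prop :=
  Function.Injective fun i => absIndex (C i)

/-- The column `w[1,k] = w(1) w(2) ⋯ w(k)`. -/
def initialColumn {n k : ℕ} (hk : k ≤ n) (w : signedPerm n) : Fin k → Letter n :=
  fun i => w.val (unbarred (Fin.castLE hk i))

/-- The matching condition on a pair of adjacent columns `C' C` of the same height: for `i < l`,
neither `C(i) = C'(l)` nor `C(i) ≺ C'(l) ≺ C'(i)` in the circular order starting at `C(i)`. -/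
def ColumnCondition {n k : ℕ} (C' C : Fin k → Letter n) : Prop :=
  ∀ i l : Fin k, i < l →
    ¬ (C i = C' l) ∧ ¬ (CircLT (C i) (C i) (C' l) ∧ CircLT (C i) (C' l) (C' i))

/-- `IsPathToColumn hk u C' v S`: `S` is a path from `u` to `v` in the quantum Bruhat graph such
that `v[1,k] = C'` and the edge labels form a subsequence of the reverse of `Γ_l(k)`. -/
def IsPathToColumn {n k : ℕ} (hk : k ≤ n) (u : signedPerm n) (C' : Fin k → Letter n)
    (v : signedPerm n) (S : List (PosRoot n × signedPerm n)) : Prop :=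
  IsQBPath u S v ∧ initialColumn hk v = C' ∧ (pathLabels S).Sublist (gammaL hk).reverse

end TypeC

/-!
The reflection exchanging the values of `w` at positions `x < y` is an edge of the quantum
Bruhat graph exactly when no position strictly between `x` and `y` has its value on the circular
arc from `w x` to `w y`; for a root `ε_i + ε_j` the two values must moreover be both unbarred or
both barred, and increasing.

Fix a signed permutation `t` whose first `k` values are the entries of `C'`. The reversed chain
treats the rows `k, …, 1` one after the other, and in row `l` it meets the positions `k + 1, …,
n, n̄, …, \overline{k+1}` and `\overline{l-1}, …, 1̄` from left to right, with the reflection of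
`2ε_l` between `n` and `n̄`. When the position `y` is met, no value between `l` and `y` is on
the arc along which `w l` still has to travel to `t l`. If `w y` lies on this arc then the step
must be taken, since later steps cannot jump over the value left behind; otherwise it must be
skipped, since it would carry the value past its target. Hence at every root the choice is
forced, which gives uniqueness and monotonicity, and the pairs from which the target is reached
are those satisfying the matching condition, which is the invariant for the rows not yet
treated.

Three phenomena are special to type C: the choice at `2ε_l` has to bring `w l` to the same half
of the alphabet as `t l`, the positions `z̄` with `l ≤ z ≤ k` are passed over without a step,
and a step labelled `(i, l̄)` disturbs the earlier row `i`. They are all controlled by comparing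
how many letters two signed permutations map into a suitable pair of arcs exchanged by the
involution.
-/

namespace TypeC

section Inversions

variable {α β : Type*} [Fintype α] [LinearOrder α] [LinearOrder β]

/-- The inversions of a map between linear orders, as pairs of positions. -/
def inversions (f : α → β) : Finset (α × α) :=
  Finset.univ.filter fun p => p.1 < p.2 ∧ f p.2 < f p.1

theorem mem_inversions {f : α → β} {p : α × α} :
    p ∈ inversions f ↔ p.1 < p.2 ∧ f p.2 < f p.1 :=
  Finset.mem_filter_univ p

/-- The positions strictly between `x` and `y` at which the value of `f` lies strictly between
`f x` and `f y`. They are what a transposition of `x` and `y` is charged for in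
`card_inversions_comp_swap`. -/
def straddled (f : α → β) (x y : α) : Finset α :=
  Finset.univ.filter fun z => (x < z ∧ z < y) ∧ (f x < f z ∧ f z < f y ∨ f y < f z ∧ f z < f x)

theorem sum_sum_eq_of_support_pair {x y : α} (hxy : x ≠ y) {D : α → α → ℤ}
    (hD : ∀ p q, p ∉ ({x, y} : Finset α) → q ∉ ({x, y} : Finset α) → D p q = 0) :
    ∑ p, ∑ q, D p q = D x x + D x y + D y x + D y y +
      ∑ z ∈ {x, y}ᶜ, (D x z + D z x + D y z + D z y) := by
  have inner (p : α) : ∑ q, D p q = D p x + D p y + ∑ z ∈ {x, y}ᶜ, D p z := by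
    rw [← Finset.sum_add_sum_compl {x, y}, Finset.sum_pair hxy]
  have outer : ∑ p ∈ ({x, y} : Finset α)ᶜ, ∑ q ∈ ({x, y} : Finset α)ᶜ, D p q = 0 :=
    Finset.sum_eq_zero fun p hp => Finset.sum_eq_zero fun q hq =>
      hD p q (Finset.mem_compl.1 hp) (Finset.mem_compl.1 hq)
  rw [← Finset.sum_add_sum_compl {x, y}, Finset.sum_pair hxy]
  simp only [inner, Finset.sum_add_distrib, outer]
  ring

theorem card_inversions_comp_swap {f : α → β} (hf : Function.Injective f) {x y : α} (hxy : x < y) :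
    ((inversions (f ∘ Equiv.swap x y)).card : ℤ) - (inversions f).card =
      (if f x < f y then 1 else -1) * (1 + 2 * (straddled f x y).card) := by
  have hfxy : f x ≠ f y := hf.ne hxy.ne
  have count (g : α → β) :
      ((inversions g).card : ℤ) = ∑ p, ∑ q, if p < q ∧ g q < g p then 1 else 0 := by
    rw [← Fintype.sum_prod_type', inversions, Finset.sum_boole]
  have mid : ((straddled f x y).card : ℤ) = ∑ z ∈ {x, y}ᶜ,
      if (x < z ∧ z < y) ∧ (f x < f z ∧ f z < f y ∨ f y < f z ∧ f z < f x) then 1 else 0 := by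
    rw [straddled, ← Finset.sum_boole, ← Finset.sum_add_sum_compl {x, y}, Finset.sum_pair hxy.ne]
    simp
  rw [count, count, ← Finset.sum_sub_distrib]
  simp only [← Finset.sum_sub_distrib]
  rw [sum_sum_eq_of_support_pair hxy.ne, mid, mul_add, Finset.mul_sum, Finset.mul_sum]
  · congr 1
    · simp only [Function.comp_apply, Equiv.swap_apply_left, Equiv.swap_apply_right]
      grind
    · refine Finset.sum_congr rfl fun z hz => ?_
      obtain ⟨hzx, hzy⟩ : z ≠ x ∧ z ≠ y := by simpa using hz
      have := hf.ne hzx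
      have := hf.ne hzy
      simp only [Function.comp_apply, Equiv.swap_apply_left, Equiv.swap_apply_right,
        Equiv.swap_apply_of_ne_of_ne hzx hzy]
      grind
  · intro p q hp hq
    simp only [Finset.mem_insert, Finset.mem_singleton, not_or] at hp hq
    simp only [Function.comp_apply, Equiv.swap_apply_of_ne_of_ne hp.1 hp.2,
      Equiv.swap_apply_of_ne_of_ne hq.1 hq.2, sub_self]

end Inversions

section WeightedSums

theorem sum_mul_comp_swap_sub {α β : Type*} [Fintype α] [DecidableEq α] (φ : α → ℤ) (ψ : β → ℤ)
    (f : α → β) (x y : α) :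
    ∑ z, φ z * ψ (f (Equiv.swap x y z)) - ∑ z, φ z * ψ (f z) =
      (φ x - φ y) * (ψ (f y) - ψ (f x)) := by
  obtain rfl | hxy := eq_or_ne x y
  · simp
  rw [← Finset.sum_sub_distrib, ← Finset.sum_add_sum_compl {x, y}, Finset.sum_pair hxy,
    Finset.sum_eq_zero (s := {x, y}ᶜ)]
  · rw [Equiv.swap_apply_left, Equiv.swap_apply_right]
    ring
  · intro z hz
    obtain ⟨hzx, hzy⟩ : z ≠ x ∧ z ≠ y := by simpa using hz
    rw [Equiv.swap_apply_of_ne_of_ne hzx hzy, sub_self]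

end WeightedSums

section Letters

variable {n : ℕ}

theorem val_bar (x : Letter n) : (bar x).val = 2 * n - 1 - x.val := by
  rw [bar, Fin.val_rev]
  omega

theorem val_unbarred (i : Fin n) : (unbarred i).val = i.val := rfl

theorem bar_bar (x : Letter n) : bar (bar x) = x := Fin.rev_rev x

theorem unbarred_lt_unbarred {i j : Fin n} : unbarred i < unbarred j ↔ i < j := Iff.rfl

theorem unbarred_lt_bar (i j : Fin n) : unbarred i < bar (unbarred j) := by
  simp only [Fin.lt_def, val_bar, val_unbarred]
  omega

theorem bar_inj {x y : Letter n} : bar x = bar y ↔ x = y := Fin.rev_inj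

theorem bar_lt_bar {x y : Letter n} : bar x < bar y ↔ y < x := Fin.rev_lt_rev

theorem signedPerm_bar (w : signedPerm n) (x : Letter n) : w.val (bar x) = bar (w.val x) :=
  w.property x

theorem circLE_iff {a x y : Letter n} :
    CircLE a x y ↔ a ≤ y ∧ a ≤ x ∧ x ≤ y ∨ y < a ∧ (a ≤ x ∨ x ≤ y) := by
  have steps (z : Letter n) : (z - a).val =
      if a.val ≤ z.val then z.val - a.val else 2 * n + z.val - a.val := by
    split_ifs with h
    · exact Fin.sub_val_of_le h
    · exact Fin.coe_sub_iff_lt.2 (not_le.1 h)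
  simp only [CircLE, Fin.le_def, Fin.lt_def, steps]
  split_ifs <;> omega

theorem circLE_bar {a x y : Letter n} : CircLE (bar y) (bar x) (bar a) ↔ CircLE a x y := by
  simp only [circLE_iff, Fin.le_def, Fin.lt_def, val_bar]
  omega

/-- `ClearBetween w x y`: no position strictly between `x` and `y` has its value on the circular
arc from `w x` to `w y`. This is the quantum Bruhat criterion for the transposition of `x` and
`y`. -/
def ClearBetween (w : signedPerm n) (x y : Letter n) : Prop :=
  ∀ z, x < z → z < y → ¬ CircLE (w.val x) (w.val z) (w.val y)

theorem clearBetween_bar {w : signedPerm n} {x y : Letter n} :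
    ClearBetween w (bar y) (bar x) ↔ ClearBetween w x y := by
  have mirror {x y : Letter n} (h : ClearBetween w x y) : ClearBetween w (bar y) (bar x) := by
    intro z hyz hzx
    rw [← bar_bar z, signedPerm_bar w x, signedPerm_bar w y, signedPerm_bar w (bar z), circLE_bar]
    exact h (bar z) (by rwa [← bar_lt_bar, bar_bar]) (by rwa [← bar_lt_bar, bar_bar])
  exact ⟨fun h => by simpa only [bar_bar] using mirror h, mirror⟩

/-- `SameSide a b`: the letters satisfy `a ≤ b` and are both unbarred or both barred. -/
def SameSide (a b : Letter n) : Prop := a ≤ b ∧ (b.val < n ∨ n ≤ a.val)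

theorem sameSide_bar {a b : Letter n} : SameSide (bar b) (bar a) ↔ SameSide a b := by
  simp only [SameSide, Fin.le_def, val_bar]
  omega

end Letters

section Length

variable {n : ℕ}

theorem length_eq_card_inversions (w : signedPerm n) :
    length w = ((inversions w.val).filter fun p => p.2 ≤ bar p.1).card := by
  refine Finset.card_bij (fun p _ => (unbarred p.1, p.2)) ?_ ?_ ?_
  · rintro ⟨p, q⟩ hpq
    have hne : unbarred p ≠ q := by
      rintro rfl
      simp at hpq
    simp only [mem_inversions, Finset.mem_filter, Finset.mem_univ, true_and, Fin.le_def,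
      Fin.lt_def, absIndex, unbarred, val_bar, ne_eq, Fin.ext_iff] at hpq hne ⊢
    omega
  · rintro ⟨p, q⟩ - ⟨p', q'⟩ - h
    simpa [unbarred, Fin.ext_iff] using h
  · rintro ⟨p, q⟩ hpq
    simp only [mem_inversions, Finset.mem_filter, Fin.le_def, Fin.lt_def, val_bar] at hpq
    refine ⟨(⟨p.val, by omega⟩, q), ?_, rfl⟩
    simp only [Finset.mem_filter, Finset.mem_univ, true_and, Fin.le_def, Fin.lt_def, absIndex,
      val_bar, unbarred, Fin.eta]
    omega

theorem card_inversions_filter_bar_le (w : signedPerm n) :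
    ((inversions w.val).filter fun p => bar p.1 ≤ p.2).card =
      ((inversions w.val).filter fun p => p.2 ≤ bar p.1).card := by
  refine Finset.card_nbij' (fun p => (bar p.2, bar p.1)) (fun p => (bar p.2, bar p.1)) ?_ ?_ ?_ ?_
  all_goals
    rintro ⟨p, q⟩ hpq
    simp only [mem_inversions, Finset.coe_filter, Set.mem_ofPred_eq, signedPerm_bar, bar_bar,
      Fin.le_def, Fin.lt_def, val_bar] at hpq ⊢
    try omega

theorem card_inversions_filter_eq_bar (w : signedPerm n) :
    ((inversions w.val).filter fun p => p.2 = bar p.1).card =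
      (Finset.univ.filter fun x : Letter n => x.val < n ∧ n ≤ (w.val x).val).card := by
  refine Finset.card_nbij' Prod.fst (fun x => (x, bar x)) ?_ ?_ ?_ fun _ _ => rfl
  · rintro ⟨p, q⟩ hpq
    obtain ⟨hinv, rfl : q = bar p⟩ := Finset.mem_filter.1 hpq
    simp only [mem_inversions, signedPerm_bar, Fin.lt_def, val_bar] at hinv
    simp only [Finset.coe_filter, Finset.mem_univ, true_and, Set.mem_ofPred_eq]
    omega
  · intro x hx
    simp only [Finset.coe_filter, Finset.mem_univ, true_and, Set.mem_ofPred_eq, mem_inversions,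
      signedPerm_bar, Fin.lt_def, val_bar, and_true] at hx ⊢
    omega
  · rintro ⟨p, q⟩ hpq
    obtain ⟨-, rfl : q = bar p⟩ := Finset.mem_filter.1 hpq
    rfl

theorem two_mul_length (w : signedPerm n) :
    2 * length w = (inversions w.val).card +
      (Finset.univ.filter fun x : Letter n => x.val < n ∧ n ≤ (w.val x).val).card := by
  have cover : ((inversions w.val).filter fun p => p.2 ≤ bar p.1) ∪
      ((inversions w.val).filter fun p => bar p.1 ≤ p.2) = inversions w.val := by
    rw [← Finset.filter_or, Finset.filter_true_of_mem fun p _ => le_total _ _]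
  have overlap : ((inversions w.val).filter fun p => p.2 ≤ bar p.1) ∩
      ((inversions w.val).filter fun p => bar p.1 ≤ p.2) =
      (inversions w.val).filter fun p => p.2 = bar p.1 := by
    simp only [← Finset.filter_and, ← le_antisymm_iff]
  have := Finset.card_union_add_card_inter ((inversions w.val).filter fun p => p.2 ≤ bar p.1)
    ((inversions w.val).filter fun p => bar p.1 ≤ p.2)
  rw [cover, overlap, card_inversions_filter_eq_bar, card_inversions_filter_bar_le,
    ← length_eq_card_inversions] at this
  omega

/-- The indicator function of the barred letters. -/
def barred (x : Letter n) : ℤ := if n ≤ x.val then 1 else 0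

theorem barred_unbarred (i : Fin n) : barred (unbarred i) = 0 :=
  if_neg (not_le.2 i.isLt)

theorem barred_bar (x : Letter n) : barred (bar x) = 1 - barred x := by
  simp only [barred, val_bar]
  split_ifs <;> omega

/-- Twice the length function, in a form that makes sense for permutations not commuting with
`bar`, so that it can be followed along each of the two transpositions of a reflection. -/
def doubledLength (σ : Equiv.Perm (Letter n)) : ℤ :=
  (inversions σ).card + ∑ x, (1 - barred x) * barred (σ x)

theorem doubledLength_signedPerm (w : signedPerm n) : doubledLength w.val = 2 * length w := by
  have term (x : Letter n) : (1 - barred x) * barred (w.val x) =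
      if x.val < n ∧ n ≤ (w.val x).val then 1 else 0 := by
    simp only [barred]
    split_ifs <;> omega
  have := two_mul_length w
  simp only [doubledLength, term, Finset.sum_boole]
  omega

theorem doubledLength_mul_swap (σ : Equiv.Perm (Letter n)) {x y : Letter n} (hxy : x < y) :
    doubledLength (σ * Equiv.swap x y) - doubledLength σ =
      (if σ x < σ y then 1 else -1) * (1 + 2 * (straddled σ x y).card) +
        (barred y - barred x) * (barred (σ y) - barred (σ x)) := by
  have weights := sum_mul_comp_swap_sub (fun z => 1 - barred z) barred σ x y
  have count := card_inversions_comp_swap σ.injective hxy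
  rw [← Equiv.Perm.coe_mul] at count
  rw [← count]
  simp only [doubledLength, Equiv.Perm.mul_apply]
  linear_combination weights

theorem straddled_subset_Ioo (σ : Equiv.Perm (Letter n)) (x y : Letter n) :
    straddled σ x y ⊆ Finset.Ioo x y := fun _ hz =>
  Finset.mem_Ioo.2 (Finset.mem_filter.1 hz).2.1

theorem card_straddled_le (σ : Equiv.Perm (Letter n)) (x y : Letter n) :
    (straddled σ x y).card ≤ y.val - x.val - 1 :=
  (Finset.card_le_card (straddled_subset_Ioo σ x y)).trans_eq (Fin.card_Ioo x y)

theorem clearBetween_iff_card {w : signedPerm n} {x y : Letter n} (hxy : x < y) :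
    ClearBetween w x y ↔
      if w.val x < w.val y then (straddled w.val x y).card = 0
      else (straddled w.val x y).card = y.val - x.val - 1 := by
  have := w.val.injective.ne hxy.ne
  have hx {z : Letter n} (h : x < z) : w.val z ≠ w.val x := w.val.injective.ne h.ne'
  have hy {z : Letter n} (h : z < y) : w.val z ≠ w.val y := w.val.injective.ne h.ne
  split_ifs with hlt
  · rw [Finset.card_eq_zero, straddled, Finset.filter_eq_empty_iff]
    simp only [ClearBetween, circLE_iff, Finset.mem_univ, forall_const]
    grind
  · have isFull : (straddled w.val x y).card = y.val - x.val - 1 ↔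
        straddled w.val x y = Finset.Ioo x y := by
      rw [← Finset.eq_iff_card_le_of_subset (straddled_subset_Ioo w.val x y), Fin.card_Ioo,
        (card_straddled_le w.val x y).ge_iff_eq]
    rw [isFull]
    simp only [Finset.ext_iff, straddled, Finset.mem_filter, Finset.mem_univ, true_and,
      Finset.mem_Ioo, and_iff_left_iff_imp, and_imp, ClearBetween, circLE_iff]
    grind

end Length

section Edges

variable {n : ℕ}

theorem corootPairing_dbl (i : Fin n) :
    corootPairing (rho n) (.dbl i) = (((n : ℤ) - (i.val : ℤ) : ℤ) : ℚ) := by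
  have inner : ∑ z, rho n z * (PosRoot.dbl i).toVec z = rho n i * 2 := by
    simp [PosRoot.toVec, Pi.single_apply]
  have norm : ∑ z, (PosRoot.dbl i).toVec z * (PosRoot.dbl i).toVec z = 4 := by
    simp [PosRoot.toVec, Pi.single_apply]; norm_num
  rw [corootPairing, inner, norm, rho]
  push_cast; ring

theorem corootPairing_sub (i j : Fin n) (h : i < j) :
    corootPairing (rho n) (.sub i j h) = (((j.val : ℤ) - (i.val : ℤ) : ℤ) : ℚ) := by
  have inner : ∑ z, rho n z * (PosRoot.sub i j h).toVec z = rho n i - rho n j := by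
    simp [PosRoot.toVec, Pi.single_apply, mul_sub]
  have norm : ∑ z, (PosRoot.sub i j h).toVec z * (PosRoot.sub i j h).toVec z = 2 := by
    simp [PosRoot.toVec, Pi.single_apply, mul_sub, h.ne, h.ne']; norm_num
  rw [corootPairing, inner, norm, rho, rho]
  push_cast; ring

theorem corootPairing_add (i j : Fin n) (h : i < j) :
    corootPairing (rho n) (.add i j h) =
      ((2 * (n : ℤ) - (j.val : ℤ) - (i.val : ℤ) : ℤ) : ℚ) := by
  have inner : ∑ z, rho n z * (PosRoot.add i j h).toVec z = rho n i + rho n j := by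
    simp [PosRoot.toVec, Pi.single_apply, mul_add, Finset.sum_add_distrib]
  have norm : ∑ z, (PosRoot.add i j h).toVec z * (PosRoot.add i j h).toVec z = 2 := by
    simp [PosRoot.toVec, Pi.single_apply, mul_add, Finset.sum_add_distrib, h.ne, h.ne']; norm_num
  rw [corootPairing, inner, norm, rho, rho]
  push_cast; ring

theorem qbEdge_iff_doubledLength {w : signedPerm n} {α : PosRoot n} {m : ℤ}
    (hm : corootPairing (rho n) α = (m : ℚ)) :
    QBEdge w α (w * α.refl) ↔
      doubledLength (w.val * α.reflPerm) - doubledLength w.val = 2 ∨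
      doubledLength (w.val * α.reflPerm) - doubledLength w.val = 2 - 4 * m := by
  have hdiff : doubledLength (w.val * α.reflPerm) - doubledLength w.val =
      2 * ((length (w * α.refl) : ℤ) - length w) := by
    rw [mul_sub, ← doubledLength_signedPerm, ← doubledLength_signedPerm]
    rfl
  have hquantum : (length (w * α.refl) : ℚ) = length w - 2 * m + 1 ↔
      (length (w * α.refl) : ℤ) = length w - 2 * m + 1 := by
    rw [← @Int.cast_inj ℚ]
    push_cast
    rfl
  rw [QBEdge, hm, hdiff, hquantum]
  simp only [true_and]
  omega

theorem doubledLength_mul_dbl (w : signedPerm n) (i : Fin n) :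
    doubledLength (w.val * (PosRoot.dbl i).reflPerm) - doubledLength w.val =
      (if w.val (unbarred i) < w.val (bar (unbarred i)) then 1 else -1) *
        (2 + 2 * (straddled w.val (unbarred i) (bar (unbarred i))).card) := by
  have sides : barred (w.val (bar (unbarred i))) - barred (w.val (unbarred i)) =
      if w.val (unbarred i) < w.val (bar (unbarred i)) then 1 else -1 := by
    simp only [barred, signedPerm_bar, Fin.lt_def, val_bar]
    split_ifs <;> omega
  rw [PosRoot.reflPerm, doubledLength_mul_swap _ (unbarred_lt_bar i i), sides, barred_bar,
    barred_unbarred]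
  ring

theorem qbEdge_dbl_iff (w : signedPerm n) (i : Fin n) :
    QBEdge w (.dbl i) (w * (PosRoot.dbl i).refl) ↔
      ClearBetween w (unbarred i) (bar (unbarred i)) := by
  have hle := card_straddled_le w.val (unbarred i) (bar (unbarred i))
  rw [qbEdge_iff_doubledLength (corootPairing_dbl i), doubledLength_mul_dbl,
    clearBetween_iff_card (unbarred_lt_bar i i)]
  simp only [val_bar, val_unbarred] at hle ⊢
  split_ifs <;> omega

theorem bar_mem_straddled_bar {σ τ : Equiv.Perm (Letter n)} {x y z : Letter n}
    (hx : σ (bar x) = bar (τ x)) (hy : σ (bar y) = bar (τ y)) (hz : σ (bar z) = bar (τ z)) :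
    bar z ∈ straddled σ (bar y) (bar x) ↔ z ∈ straddled τ x y := by
  simp only [straddled, Finset.mem_filter, Finset.mem_univ, true_and, hx, hy, hz, bar_lt_bar]
  tauto

theorem mul_swap_bar {w : signedPerm n} {x y z : Letter n} (hx : z ≠ bar x) (hy : z ≠ bar y) :
    (w.val * Equiv.swap x y) (bar z) = bar (w.val z) := by
  rw [Equiv.Perm.mul_apply, Equiv.swap_apply_of_ne_of_ne, signedPerm_bar]
  · exact fun h => hx (by rw [← h, bar_bar])
  · exact fun h => hy (by rw [← h, bar_bar])

theorem doubledLength_mul_sub (w : signedPerm n) (i j : Fin n) (h : i < j) :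
    doubledLength (w.val * (PosRoot.sub i j h).reflPerm) - doubledLength w.val =
      (if w.val (unbarred i) < w.val (unbarred j) then 1 else -1) *
        (2 + 4 * (straddled w.val (unbarred i) (unbarred j)).card) := by
  have hlt := unbarred_lt_unbarred.2 h
  set σ := w.val * Equiv.swap (unbarred i) (unbarred j) with hσ
  have opposite (z : Letter n) (hz : z.val < n) : σ (bar z) = bar (w.val z) := by
    refine mul_swap_bar ?_ ?_ <;>
    · simp only [ne_eq, Fin.ext_iff, val_bar, val_unbarred]
      omega
  have mirror : (straddled σ (bar (unbarred j)) (bar (unbarred i))).card =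
      (straddled w.val (unbarred i) (unbarred j)).card := by
    have low {z : Letter n} (hz : z < unbarred j) : z.val < n := lt_trans hz j.isLt
    refine Finset.card_nbij' bar bar (fun z hz => ?_) (fun z hz => ?_) (fun z _ => bar_bar z)
      fun z _ => bar_bar z
    · have hlow : (bar z).val < n := low <| by
        rw [← bar_lt_bar, bar_bar]
        exact (Finset.mem_Ioo.1 (straddled_subset_Ioo _ _ _ hz)).1
      rwa [← bar_bar z, Finset.mem_coe, bar_mem_straddled_bar (opposite _ i.isLt)
        (opposite _ j.isLt) (opposite _ hlow)] at hz
    · have hlow : z.val < n := low (Finset.mem_Ioo.1 (straddled_subset_Ioo _ _ _ hz)).2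
      exact (bar_mem_straddled_bar (opposite _ i.isLt) (opposite _ j.isLt) (opposite _ hlow)).2 hz
  have first := doubledLength_mul_swap w.val hlt
  have second := doubledLength_mul_swap σ (bar_lt_bar.2 hlt)
  simp only [mirror, opposite (unbarred i) i.isLt, opposite (unbarred j) j.isLt, bar_lt_bar,
    barred_bar, barred_unbarred] at first second
  rw [PosRoot.reflPerm, ← mul_assoc, ← hσ]
  linear_combination first + second

theorem qbEdge_sub_iff (w : signedPerm n) (i j : Fin n) (h : i < j) :
    QBEdge w (.sub i j h) (w * (PosRoot.sub i j h).refl) ↔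
      ClearBetween w (unbarred i) (unbarred j) := by
  have hle := card_straddled_le w.val (unbarred i) (unbarred j)
  have := Fin.lt_def.1 h
  rw [qbEdge_iff_doubledLength (corootPairing_sub i j h), doubledLength_mul_sub,
    clearBetween_iff_card (unbarred_lt_unbarred.2 h)]
  simp only [val_unbarred] at hle ⊢
  split_ifs <;> omega

theorem mul_swap_add_bar_left (w : signedPerm n) {i j : Fin n} (h : i < j) :
    (w.val * Equiv.swap (unbarred i) (bar (unbarred j))) (bar (unbarred i)) =
      bar (w.val (unbarred i)) :=
  mul_swap_bar (unbarred_lt_bar i i).ne (by rw [bar_bar]; exact Fin.ne_of_lt h)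

theorem mul_swap_add_right (w : signedPerm n) {i j : Fin n} (h : i < j) :
    (w.val * Equiv.swap (unbarred i) (bar (unbarred j))) (unbarred j) =
      bar (w.val (bar (unbarred j))) := by
  have := mul_swap_bar (w := w) (bar_lt_bar.2 (unbarred_lt_unbarred.2 h)).ne
    fun e => (unbarred_lt_bar j j).ne (bar_inj.1 e)
  rwa [bar_bar] at this

theorem doubledLength_mul_add (w : signedPerm n) (i j : Fin n) (h : i < j) :
    doubledLength (w.val * (PosRoot.add i j h).reflPerm) - doubledLength w.val =
      (if w.val (unbarred i) < w.val (bar (unbarred j)) then 1 else -1) *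
        (2 + 2 * (straddled w.val (unbarred i) (bar (unbarred j))).card +
          2 * (straddled (w.val * Equiv.swap (unbarred i) (bar (unbarred j))) (unbarred j)
            (bar (unbarred i))).card) +
        2 * (barred (w.val (bar (unbarred j))) - barred (w.val (unbarred i))) := by
  set σ := w.val * Equiv.swap (unbarred i) (bar (unbarred j)) with hσ
  have h_i : σ (bar (unbarred i)) = bar (w.val (unbarred i)) := mul_swap_add_bar_left w h
  have h_j : σ (unbarred j) = bar (w.val (bar (unbarred j))) := mul_swap_add_right w h
  have first := doubledLength_mul_swap w.val (unbarred_lt_bar i j)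
  have second := doubledLength_mul_swap σ (unbarred_lt_bar j i)
  simp only [h_i, h_j, bar_lt_bar, barred_bar, barred_unbarred] at first second
  rw [PosRoot.reflPerm, ← mul_assoc, ← hσ]
  linear_combination first + second

theorem straddled_mul_swap_add_eq_empty {w : signedPerm n} {i j : Fin n} (h : i < j)
    (hside : SameSide (w.val (unbarred i)) (w.val (bar (unbarred j))))
    (hempty : straddled w.val (unbarred i) (bar (unbarred j)) = ∅) :
    straddled (w.val * Equiv.swap (unbarred i) (bar (unbarred j))) (unbarred j)
      (bar (unbarred i)) = ∅ := by
  refine Finset.eq_empty_of_forall_notMem fun z hz => ?_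
  have hzi : unbarred i < z :=
    lt_trans (unbarred_lt_unbarred.2 h)
      (Finset.mem_Ioo.1 (straddled_subset_Ioo _ _ _ hz)).1
  obtain rfl | hzj := eq_or_ne z (bar (unbarred j))
  · simp only [straddled, Finset.mem_filter, mul_swap_add_right w h, mul_swap_add_bar_left w h,
      Equiv.Perm.mul_apply, Equiv.swap_apply_right, Fin.lt_def, val_bar] at hz
    simp only [SameSide, Fin.le_def] at hside
    omega
  · have hz_bar : (w.val * Equiv.swap (unbarred i) (bar (unbarred j))) (bar (bar z)) =
        bar (w.val (bar z)) :=
      mul_swap_bar (fun e => hzi.ne' (bar_inj.1 e)) fun e => hzj (bar_inj.1 e)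
    have := (bar_mem_straddled_bar (mul_swap_add_bar_left w h) (y := bar (unbarred j))
      (by rw [bar_bar, mul_swap_add_right w h]) hz_bar).1 (by rwa [bar_bar, bar_bar])
    exact absurd this (by rw [hempty]; exact Finset.notMem_empty _)

theorem qbEdge_add_iff (w : signedPerm n) (i j : Fin n) (h : i < j) :
    QBEdge w (.add i j h) (w * (PosRoot.add i j h).refl) ↔
      SameSide (w.val (unbarred i)) (w.val (bar (unbarred j))) ∧
        ClearBetween w (unbarred i) (bar (unbarred j)) := by
  have hle := card_straddled_le w.val (unbarred i) (bar (unbarred j))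
  have hle' := card_straddled_le (w.val * Equiv.swap (unbarred i) (bar (unbarred j)))
    (unbarred j) (bar (unbarred i))
  have := Fin.lt_def.1 h
  have hempty := straddled_mul_swap_add_eq_empty (w := w) h
  simp only [← Finset.card_eq_zero] at hempty
  have hne : w.val (unbarred i) ≠ w.val (bar (unbarred j)) :=
    w.val.injective.ne (unbarred_lt_bar i j).ne
  rw [qbEdge_iff_doubledLength (corootPairing_add i j h), doubledLength_mul_add,
    clearBetween_iff_card (unbarred_lt_bar i j)]
  simp only [SameSide, barred, val_bar, val_unbarred, Fin.lt_def, Fin.le_def, ne_eq,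
    Fin.ext_iff] at hle hle' hempty hne ⊢
  split_ifs <;> omega

theorem qbEdge_add_iff_bar (w : signedPerm n) (i j : Fin n) (h : i < j) :
    QBEdge w (.add i j h) (w * (PosRoot.add i j h).refl) ↔
      SameSide (w.val (unbarred j)) (w.val (bar (unbarred i))) ∧
        ClearBetween w (unbarred j) (bar (unbarred i)) := by
  rw [qbEdge_add_iff, ← sameSide_bar, ← clearBetween_bar, ← signedPerm_bar, ← signedPerm_bar,
    bar_bar]

end Edges

section Paths

variable {n : ℕ}

theorem isQBPath_append {w v : signedPerm n} {S T : List (PosRoot n × signedPerm n)} :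
    IsQBPath w (S ++ T) v ↔ ∃ m, IsQBPath w S m ∧ IsQBPath m T v := by
  induction S generalizing w with
  | nil => simp [IsQBPath]
  | cons a S ih =>
    obtain ⟨α, x⟩ := a
    simp only [List.cons_append, IsQBPath, ih]
    tauto

theorem isChain_pathVertices_append {R : signedPerm n → signedPerm n → Prop} {w m : signedPerm n}
    {S T : List (PosRoot n × signedPerm n)} (h : IsQBPath w S m)
    (hS : (pathVertices w S).IsChain R) (hT : (pathVertices m T).IsChain R) :
    (pathVertices w (S ++ T)).IsChain R := by
  induction S generalizing w with
  | nil =>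
    obtain rfl : w = m := h
    exact hT
  | cons a S ih =>
    obtain ⟨α, x⟩ := a
    simp only [pathVertices, List.cons_append, List.map_cons, List.isChain_cons_cons] at hS ⊢
    exact ⟨hS.1, ih h.2 hS.2⟩

theorem IsQBPath.end_unique {w v v' : signedPerm n} {S : List (PosRoot n × signedPerm n)}
    (h : IsQBPath w S v) (h' : IsQBPath w S v') : v = v' := by
  induction S generalizing w with
  | nil => exact h.symm.trans h'
  | cons a S ih => exact ih h.2 h'.2

theorem IsQBPath.exists_split {w v : signedPerm n} {S : List (PosRoot n × signedPerm n)}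
    {L M : List (PosRoot n)} (h : IsQBPath w S v) (hL : (pathLabels S).Sublist (L ++ M)) :
    ∃ S₁ S₂ m, S = S₁ ++ S₂ ∧ IsQBPath w S₁ m ∧ IsQBPath m S₂ v ∧
      (pathLabels S₁).Sublist L ∧ (pathLabels S₂).Sublist M := by
  obtain ⟨l₁, l₂, hsplit, h₁, h₂⟩ := List.sublist_append_iff.1 hL
  obtain ⟨S₁, S₂, rfl, rfl, rfl⟩ := List.map_eq_append_iff.1 hsplit
  obtain ⟨m, hS₁, hS₂⟩ := isQBPath_append.1 h
  exact ⟨S₁, S₂, m, rfl, hS₁, hS₂, h₁, h₂⟩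

theorem IsQBPath.eq_of_sublist_singleton {w v : signedPerm n}
    {S : List (PosRoot n × signedPerm n)} {α : PosRoot n} (h : IsQBPath w S v)
    (hL : (pathLabels S).Sublist [α]) :
    S = [] ∧ v = w ∨ S = [(α, w * α.refl)] ∧ v = w * α.refl ∧ QBEdge w α (w * α.refl) := by
  obtain hS | hS := List.sublist_singleton.1 hL
  · obtain rfl := List.map_eq_nil_iff.1 hS
    exact Or.inl ⟨rfl, h.symm⟩
  · obtain ⟨⟨β, x⟩, rfl, rfl⟩ := List.map_eq_singleton_iff.1 hS
    obtain ⟨hE, rfl⟩ := h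
    obtain rfl := hE.1
    exact Or.inr ⟨rfl, rfl, hE⟩

/-- A Hoare triple for the chain of roots `L`: the vertices satisfying `A` are exactly the starting
points of the paths in the quantum Bruhat graph which have labels forming a subsequence of `L` and
end in a vertex satisfying `B`; such a path is determined by its starting point, and all its steps
satisfy `R`. -/
structure PathTriple (R : signedPerm n → signedPerm n → Prop) (A : signedPerm n → Prop)
    (L : List (PosRoot n)) (B : signedPerm n → Prop) : Prop where
  exists_path : ∀ w, A w → ∃ S v, IsQBPath w S v ∧ (pathLabels S).Sublist L ∧ B v
  source : ∀ w S v, IsQBPath w S v → (pathLabels S).Sublist L → B v →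
    A w ∧ (pathVertices w S).IsChain R
  unique : ∀ w S v S' v', IsQBPath w S v → (pathLabels S).Sublist L → B v →
    IsQBPath w S' v' → (pathLabels S').Sublist L → B v' → S = S'

namespace PathTriple

variable {R : signedPerm n → signedPerm n → Prop} {A B C : signedPerm n → Prop}
  {L M : List (PosRoot n)}

theorem nil (A : signedPerm n → Prop) : PathTriple R A [] A where
  exists_path w hw := ⟨[], w, rfl, List.Sublist.refl _, hw⟩
  source w S v hS hL hA := by
    obtain rfl := List.map_eq_nil_iff.1 (List.sublist_nil.1 hL)
    obtain rfl : w = v := hS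
    exact ⟨hA, List.isChain_singleton _⟩
  unique w S v S' v' _ hL _ _ hL' _ := by
    rw [List.map_eq_nil_iff.1 (List.sublist_nil.1 hL),
      List.map_eq_nil_iff.1 (List.sublist_nil.1 hL')]

theorem append (h₁ : PathTriple R A L B) (h₂ : PathTriple R B M C) :
    PathTriple R A (L ++ M) C where
  exists_path w hw := by
    obtain ⟨S, m, hS, hL, hB⟩ := h₁.exists_path w hw
    obtain ⟨T, v, hT, hM, hC⟩ := h₂.exists_path m hB
    refine ⟨S ++ T, v, isQBPath_append.2 ⟨m, hS, hT⟩, ?_, hC⟩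
    simpa only [pathLabels, List.map_append] using hL.append hM
  source w S v hS hL hC := by
    obtain ⟨S₁, S₂, m, rfl, hS₁, hS₂, hL₁, hL₂⟩ := hS.exists_split hL
    obtain ⟨hB, chain₂⟩ := h₂.source m S₂ v hS₂ hL₂ hC
    obtain ⟨hA, chain₁⟩ := h₁.source w S₁ m hS₁ hL₁ hB
    exact ⟨hA, isChain_pathVertices_append hS₁ chain₁ chain₂⟩
  unique w S v S' v' hS hL hC hS' hL' hC' := by
    obtain ⟨S₁, S₂, m, rfl, hS₁, hS₂, hL₁, hL₂⟩ := hS.exists_split hL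
    obtain ⟨T₁, T₂, m', rfl, hT₁, hT₂, hM₁, hM₂⟩ := hS'.exists_split hL'
    have hB := (h₂.source m S₂ v hS₂ hL₂ hC).1
    have hB' := (h₂.source m' T₂ v' hT₂ hM₂ hC').1
    obtain rfl := h₁.unique w S₁ m T₁ m' hS₁ hL₁ hB hT₁ hM₁ hB'
    obtain rfl := hS₁.end_unique hT₁
    rw [h₂.unique m S₂ v T₂ v' hS₂ hL₂ hC hT₂ hM₂ hC']

theorem single (α : PosRoot n) {G : signedPerm n → Prop} (stay : ∀ w, B w ↔ A w ∧ ¬ G w)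
    (step : ∀ w, QBEdge w α (w * α.refl) ∧ B (w * α.refl) ↔ A w ∧ G w)
    (rel : ∀ w, A w → G w → R w (w * α.refl)) : PathTriple R A [α] B where
  exists_path w hA := by
    by_cases hG : G w
    · obtain ⟨hE, hB⟩ := (step w).2 ⟨hA, hG⟩
      exact ⟨[(α, w * α.refl)], _, ⟨hE, rfl⟩, List.Sublist.refl _, hB⟩
    · exact ⟨[], w, rfl, List.nil_sublist _, (stay w).2 ⟨hA, hG⟩⟩
  source w S v hS hL hB := by
    obtain ⟨rfl, rfl⟩ | ⟨rfl, rfl, hE⟩ := hS.eq_of_sublist_singleton hL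
    · exact ⟨((stay v).1 hB).1, List.isChain_singleton _⟩
    · obtain ⟨hA, hG⟩ := (step w).1 ⟨hE, hB⟩
      exact ⟨hA, List.isChain_pair.2 (rel w hA hG)⟩
  unique w S v S' v' hS hL hB hS' hL' hB' := by
    obtain ⟨rfl, rfl⟩ | ⟨rfl, rfl, hE⟩ := hS.eq_of_sublist_singleton hL <;>
      obtain ⟨rfl, rfl⟩ | ⟨rfl, rfl, hE'⟩ := hS'.eq_of_sublist_singleton hL'
    · rfl
    · exact absurd ((step _).1 ⟨hE', hB'⟩).2 ((stay _).1 hB).2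
    · exact absurd ((step _).1 ⟨hE, hB⟩).2 ((stay _).1 hB').2
    · rfl

theorem congr {A' B' : signedPerm n → Prop} (h : PathTriple R A L B) (hA : ∀ w, A w ↔ A' w)
    (hB : ∀ w, B w ↔ B' w) : PathTriple R A' L B' := by
  rwa [← funext fun w => propext (hA w), ← funext fun w => propext (hB w)]

theorem flatMap_finRange (m : ℕ) (F : Fin m → List (PosRoot n)) (Q : ℕ → signedPerm n → Prop)
    (h : ∀ j : Fin m, PathTriple R (Q j) (F j) (Q (j + 1))) :
    PathTriple R (Q 0) ((List.finRange m).flatMap F) (Q m) := by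
  induction m with
  | zero => exact nil _
  | succ m ih =>
    rw [List.finRange_succ_last, List.flatMap_append, List.flatMap_map]
    refine (ih (fun j => F j.castSucc) fun j => h j.castSucc).append ?_
    simpa using h (Fin.last m)

theorem flatMap_finRange_reverse (m : ℕ) (F : Fin m → List (PosRoot n))
    (Q : ℕ → signedPerm n → Prop) (h : ∀ j : Fin m, PathTriple R (Q (j + 1)) (F j) (Q j)) :
    PathTriple R (Q m) ((List.finRange m).reverse.flatMap F) (Q 0) := by
  induction m with
  | zero => exact nil _
  | succ m ih =>
    rw [List.finRange_succ_last, List.reverse_append, List.flatMap_append, ← List.map_reverse,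
      List.flatMap_map]
    refine append (B := Q m) ?_ (ih (fun j => F j.castSucc) fun j => h j.castSucc)
    simpa using h (Fin.last m)

section FilterMap

variable (m : ℕ) (p : Fin m → Prop) [DecidablePred p] (F : ∀ j, p j → PosRoot n)
  (Q : ℕ → signedPerm n → Prop)

theorem filterMap_finRange (h : ∀ j (hj : p j), PathTriple R (Q j) [F j hj] (Q (j + 1)))
    (h' : ∀ j, ¬ p j → Q j = Q (j + 1)) :
    PathTriple R (Q 0)
      ((List.finRange m).filterMap fun j => if hj : p j then some (F j hj) else none) (Q m) := by
  rw [List.filterMap_eq_flatMap_toList]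
  refine flatMap_finRange m _ Q fun j => ?_
  split_ifs with hj
  · exact h j hj
  · exact h' j hj ▸ nil _

theorem filterMap_finRange_reverse (h : ∀ j (hj : p j), PathTriple R (Q (j + 1)) [F j hj] (Q j))
    (h' : ∀ j, ¬ p j → Q j = Q (j + 1)) :
    PathTriple R (Q m)
      ((List.finRange m).reverse.filterMap fun j => if hj : p j then some (F j hj) else none)
      (Q 0) := by
  rw [List.filterMap_eq_flatMap_toList]
  refine flatMap_finRange_reverse m _ Q fun j => ?_
  split_ifs with hj
  · exact h j hj
  · exact h' j hj ▸ nil _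

end FilterMap

end PathTriple

end Paths

section Circle

variable {n : ℕ} {a b c d x y : Letter n}

theorem circLE_left (a y : Letter n) : CircLE a a y := by
  simp only [circLE_iff, Fin.le_def, Fin.lt_def]
  omega

theorem circLE_of_circLE_of_not_circLE (h : CircLE b x d) (h' : ¬ CircLE x d y) :
    CircLE b y d := by
  simp only [circLE_iff, Fin.le_def, Fin.lt_def] at *
  omega

/-- The half-open circular arc from `a` (excluded) to `b` (included); it is empty if `a = b`. -/
def CircIoc (a b : Letter n) : Set (Letter n) := {x | x ≠ a ∧ CircLE a x b}

theorem mem_circIoc_iff : x ∈ CircIoc a b ↔ a < x ∧ x ≤ b ∨ b < a ∧ (a < x ∨ x ≤ b) := by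
  simp only [CircIoc, Set.mem_ofPred_eq, circLE_iff, Fin.le_def, Fin.lt_def, ne_eq, Fin.ext_iff]
  omega

theorem right_mem_circIoc (h : a ≠ b) : b ∈ CircIoc a b := by
  simp only [mem_circIoc_iff, Fin.le_def, Fin.lt_def, ne_eq, Fin.ext_iff] at *
  omega

theorem mem_circIoc_split (hb : b ∈ CircIoc a c) :
    x ∈ CircIoc a c ↔ x ∈ CircIoc a b ∨ x ∈ CircIoc b c := by
  simp only [mem_circIoc_iff, Fin.le_def, Fin.lt_def] at *
  omega

theorem mem_circIoc_iff_notMem (h : a ≠ b) : b ∈ CircIoc a c ↔ a ∉ CircIoc b c := by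
  simp only [mem_circIoc_iff, Fin.le_def, Fin.lt_def, ne_eq, Fin.ext_iff] at *
  omega

theorem SameSide.of_mem_circIoc (hside : SameSide a c) (hb : b ∈ CircIoc a c) :
    SameSide a b ∧ SameSide b c := by
  simp only [SameSide, mem_circIoc_iff, Fin.le_def, Fin.lt_def] at *
  omega

theorem SameSide.trans (hab : SameSide a b) (hbc : SameSide b c) : SameSide a c := by
  simp only [SameSide, Fin.le_def] at *
  omega

theorem SameSide.bar_notMem_circIoc (hside : SameSide a c) (hx : SameSide a x ∨ SameSide x c) :
    bar x ∉ CircIoc a c := by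
  simp only [SameSide, mem_circIoc_iff, Fin.le_def, Fin.lt_def, val_bar] at *
  omega

end Circle

section Twin

variable {n : ℕ} {c d x y : Letter n} {w t : signedPerm n}

/-- The union of the circular arcs from `c̄` to `d` and from `d̄` to `c`, which are exchanged by
barring. It is the test set of the counting argument `mem_twinArcs_of_forall`. -/
def twinArcs (c d : Letter n) : Set (Letter n) := {x | CircLE (bar c) x d ∨ CircLE (bar d) x c}

theorem bar_mem_twinArcs : bar x ∈ twinArcs c d ↔ x ∈ twinArcs c d := by
  have first : CircLE (bar c) (bar x) d ↔ CircLE (bar d) x c := by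
    conv_lhs => rw [← bar_bar d, circLE_bar]
  have second : CircLE (bar d) (bar x) c ↔ CircLE (bar c) x d := by
    conv_lhs => rw [← bar_bar c, circLE_bar]
  rw [twinArcs, Set.mem_ofPred_eq, Set.mem_ofPred_eq, first, second, or_comm]

theorem mem_twinArcs_of_not_circLE (hc : ¬ CircLE x c y) (hd : ¬ CircLE x d y)
    (hx : x ∈ twinArcs c d) : y ∈ twinArcs c d :=
  hx.imp (circLE_of_circLE_of_not_circLE · hd) (circLE_of_circLE_of_not_circLE · hc)

theorem mem_of_forall_mem_imp {α : Type*} [Finite α] {σ τ : Equiv.Perm α} {s : Set α}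
    (h : ∀ x, σ x ∈ s → τ x ∈ s) {x : α} (hx : τ x ∈ s) : σ x ∈ s := by
  have hsub : σ ⁻¹' s ⊆ τ ⁻¹' s := h
  have hcard : (τ ⁻¹' s).ncard ≤ (σ ⁻¹' s).ncard := by
    rw [Set.ncard_preimage_of_injective_subset_range σ.injective (by simp),
      Set.ncard_preimage_of_injective_subset_range τ.injective (by simp)]
  exact (Set.eq_of_subset_of_ncard_le hsub hcard).symm.subset hx

theorem mem_twinArcs_of_forall
    (h : ∀ x : Letter n, x.val < n → w.val x ∈ twinArcs c d → t.val x ∈ twinArcs c d)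
    (hx : t.val x ∈ twinArcs c d) : w.val x ∈ twinArcs c d := by
  refine mem_of_forall_mem_imp (fun z hz => ?_) hx
  by_cases hzn : z.val < n
  · exact h z hzn hz
  · rw [← bar_bar z, signedPerm_bar, bar_mem_twinArcs] at hz ⊢
    exact h (bar z) (by rw [val_bar]; omega) hz

end Twin

section TwinArcsOnCircle

variable {n : ℕ} {a b c d x y : Letter n}

theorem SameSide.refl (a : Letter n) : SameSide a a := by
  simp only [SameSide, Fin.le_def]
  omega

theorem right_mem_twinArcs : d ∈ twinArcs c d := by
  simp only [twinArcs, Set.mem_ofPred_eq, circLE_iff, Fin.le_def, Fin.lt_def, val_bar]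
  omega

theorem left_mem_twinArcs : c ∈ twinArcs c d := by
  simp only [twinArcs, Set.mem_ofPred_eq, circLE_iff, Fin.le_def, Fin.lt_def, val_bar]
  omega

theorem notMem_twinArcs_self (hside : ¬ SameSide a c) (ha : bar a ∉ CircIoc a c) :
    a ∉ twinArcs c c := by
  simp only [twinArcs, Set.mem_ofPred_eq, SameSide, mem_circIoc_iff, circLE_iff, Fin.le_def,
    Fin.lt_def, val_bar] at *
  omega

theorem twinArcs_self_subset_circIoc (ha : a ∉ twinArcs c c) : twinArcs c c ⊆ CircIoc a c := by
  intro x hx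
  simp only [twinArcs, Set.mem_ofPred_eq, mem_circIoc_iff, circLE_iff, Fin.le_def,
    Fin.lt_def, val_bar] at *
  omega

theorem SameSide.notMem_twinArcs (hside : SameSide a c) (hd : bar d ∈ CircIoc a c) :
    a ∉ twinArcs c d := by
  simp only [twinArcs, Set.mem_ofPred_eq, SameSide, mem_circIoc_iff, circLE_iff, Fin.le_def,
    Fin.lt_def, val_bar] at *
  omega

theorem SameSide.mem_circIoc_of_circLE (hside : SameSide a c) (hd : bar d ∈ CircIoc a c)
    (hx : CircLE (bar d) x c) : x ∈ CircIoc a c := by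
  simp only [SameSide, mem_circIoc_iff, circLE_iff, Fin.le_def, Fin.lt_def, val_bar] at *
  omega

theorem SameSide.circLE_of_circLE (hside : SameSide a c) (hd : bar d ∈ CircIoc a c)
    (hx : CircLE (bar d) x c) : CircLE x c d := by
  simp only [SameSide, mem_circIoc_iff, circLE_iff, Fin.le_def, Fin.lt_def, val_bar] at *
  omega

theorem SameSide.mem_circIoc_of_mem_twinArcs (hside : SameSide a c) (hd : bar d ∈ CircIoc a c)
    (hx : x ∈ twinArcs c d) : x ∈ CircIoc a c ∨ bar x ∈ CircIoc a c := by
  refine hx.symm.imp (hside.mem_circIoc_of_circLE hd) fun h => hside.mem_circIoc_of_circLE hd ?_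
  rwa [← circLE_bar, bar_bar] at h

theorem circLE_bar_left_iff (hx : bar x ∉ CircIoc a b) (hy : bar y ∉ CircIoc a b) :
    CircLE (bar b) x y ↔ CircLE (bar a) x y := by
  simp only [mem_circIoc_iff, circLE_iff, Fin.le_def, Fin.lt_def, val_bar] at *
  omega

theorem circLE_bar_bar_of_notMem (hy : bar y ∉ CircIoc a b) : CircLE (bar b) (bar a) y := by
  simp only [mem_circIoc_iff, circLE_iff, Fin.le_def, Fin.lt_def, val_bar] at *
  omega

end TwinArcsOnCircle

section Rows

variable {n k : ℕ} {t w w' : signedPerm n} {l x y z : Letter n} {m : ℕ}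

/-- The condition on row `x` in the matching condition for the columns `t[1,k]` and `w[1,k]`: no
later entry of `t[1,k]` lies on the circular arc from `w x` to `t x`. -/
def RowClear (t : signedPerm n) (k : ℕ) (w : signedPerm n) (x : Letter n) : Prop :=
  ∀ z, x < z → z.val < k → ¬ CircLE (w.val x) (t.val z) (t.val x)

/-- The vertices reached once the rows `m, …, k - 1` have been processed: these rows agree with the
target `t`, and the rows before them still satisfy the matching condition. -/
structure MatchedFrom (t : signedPerm n) (k m : ℕ) (w : signedPerm n) : Prop where
  rows : ∀ x : Letter n, x.val < m → RowClear t k w x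
  matched : ∀ z : Letter n, m ≤ z.val → z.val < k → w.val z = t.val z

/-- The condition on all rows except `l` while row `l` is being processed. -/
structure ActiveRow (t : signedPerm n) (k : ℕ) (l : Letter n) (w : signedPerm n) : Prop where
  rows : ∀ x < l, RowClear t k w x
  matched : ∀ z, l < z → z.val < k → w.val z = t.val z

/-- `ClearBelow t l m w`: after position `l` and before position `m`, no value of `w` lies on the
circular arc along which the value at `l` still has to travel. This is the invariant of the
processing of row `l`; the bound `m` moves past a position when its reflection is considered. -/
def ClearBelow (t : signedPerm n) (l : Letter n) (m : ℕ) (w : signedPerm n) : Prop :=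
  ∀ z, l < z → z.val < m → w.val z ∉ CircIoc (w.val l) (t.val l)

theorem clearBelow_succ (hly : l < y) :
    ClearBelow t l (y.val + 1) w ↔
      ClearBelow t l y w ∧ w.val y ∉ CircIoc (w.val l) (t.val l) := by
  refine ⟨fun h => ⟨fun z hz hzy => h z hz (by omega), h y hly (by omega)⟩, fun h z hz hzy => ?_⟩
  obtain hlt | heq := Nat.lt_succ_iff_lt_or_eq.1 hzy
  · exact h.1 z hz hlt
  · rw [Fin.ext heq]
    exact h.2

theorem matchedFrom_succ_iff (hl : l.val < k) :
    MatchedFrom t k (l + 1) w ↔ ActiveRow t k l w ∧ ClearBelow t l k w := by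
  constructor
  · intro h
    refine ⟨⟨fun x hx => h.rows x (Nat.lt_succ_of_lt hx), fun z hz => h.matched z hz⟩, ?_⟩
    intro z hlz hzk hmem
    rw [h.matched z hlz hzk] at hmem
    exact h.rows l (Nat.lt_succ_self _) z hlz hzk hmem.2
  · rintro ⟨h, hclear⟩
    refine ⟨fun x hx => ?_, fun z hz => h.matched z hz⟩
    obtain hlt | heq := Nat.lt_succ_iff_lt_or_eq.1 hx
    · exact h.rows x hlt
    · obtain rfl := Fin.ext heq
      intro z hxz hzk hmem
      rw [← h.matched z hxz hzk] at hmem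
      exact hclear z hxz hzk ⟨w.val.injective.ne hxz.ne', hmem⟩

theorem matchedFrom_iff (hl : l.val < k) :
    MatchedFrom t k l w ↔
      ActiveRow t k l w ∧ SameSide (w.val l) (t.val l) ∧ ClearBelow t l (2 * n) w := by
  constructor
  · intro h
    have hw := h.matched l le_rfl hl
    refine ⟨⟨h.rows, fun z hz => h.matched z (le_of_lt hz)⟩, hw ▸ SameSide.refl _, ?_⟩
    rintro z - - hmem
    rw [hw, mem_circIoc_iff] at hmem
    simp only [Fin.le_def, Fin.lt_def] at hmem
    omega
  · rintro ⟨h, -, hclear⟩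
    refine ⟨h.rows, fun z hz hzk => ?_⟩
    obtain hlt | heq := lt_or_eq_of_le hz
    · exact h.matched z hlt hzk
    obtain rfl := Fin.ext heq
    obtain ⟨x, hx⟩ := w.val.surjective (t.val l)
    obtain hxl | rfl | hlx := lt_trichotomy x l
    · exact absurd (hx ▸ circLE_left _ _) (h.rows x hxl l hxl hl)
    · exact hx
    · refine absurd ?_ (hclear x hlx x.isLt)
      rw [hx]
      exact right_mem_circIoc (hx ▸ w.val.injective.ne hlx.ne)

theorem activeRow_congr (h : ∀ x, x ≠ l → x.val < k → w'.val x = w.val x) (hl : l.val < k) :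
    ActiveRow t k l w' ↔ ActiveRow t k l w := by
  refine ⟨fun hA => ⟨fun x hx => ?_, fun z hz hzk => ?_⟩,
    fun hA => ⟨fun x hx => ?_, fun z hz hzk => ?_⟩⟩
  · simpa only [RowClear, h x hx.ne (lt_trans hx hl)] using hA.rows x hx
  · rw [← h z hz.ne' hzk, hA.matched z hz hzk]
  · simpa only [RowClear, h x hx.ne (lt_trans hx hl)] using hA.rows x hx
  · rw [h z hz.ne' hzk, hA.matched z hz hzk]

-- `w` and `t` map equally many letters into the twin arcs, so `t` cannot gain `l`.
theorem ActiveRow.false_of_notMem_twinArcs (h : ActiveRow t k l w) (hl : l.val < k)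
    (hly : l ≤ y) (hyk : y.val < k) (hleft : w.val l ∉ twinArcs (t.val l) (t.val y))
    (hfree : ∀ x : Letter n, k ≤ x.val → x.val < n → w.val x ∉ twinArcs (t.val l) (t.val y)) :
    False := by
  refine hleft (mem_twinArcs_of_forall (t := t) (fun x hxn hx => ?_) left_mem_twinArcs)
  obtain hxl | rfl | hlx := lt_trichotomy x l
  · exact mem_twinArcs_of_not_circLE (h.rows x hxl l hxl hl)
      (h.rows x hxl y (hxl.trans_le hly) hyk) hx
  · exact absurd hx hleft
  · obtain hxk | hkx := lt_or_ge x.val k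
    · rwa [← h.matched x hlx hxk]
    · exact absurd hx (hfree x hkx hxn)

theorem ActiveRow.sameSide_iff (h : ActiveRow t k l w) (hl : l.val < k)
    (hclear : ClearBelow t l n w) :
    SameSide (w.val l) (t.val l) ↔ bar (w.val l) ∉ CircIoc (w.val l) (t.val l) := by
  refine ⟨fun hside => hside.bar_notMem_circIoc (Or.inr hside), fun hbar => ?_⟩
  by_contra hside
  have hleft := notMem_twinArcs_self hside hbar
  exact h.false_of_notMem_twinArcs hl le_rfl hl hleft fun x hkx hxn hx =>
    hclear x (hl.trans_le hkx) hxn (twinArcs_self_subset_circIoc hleft hx)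

theorem ActiveRow.clearBelow_mirror (h : ActiveRow t k l w) (hl : l.val < k) (hk : k ≤ n)
    (hside : SameSide (w.val l) (t.val l)) (hclear : ClearBelow t l (2 * n - k) w) :
    ClearBelow t l (2 * n - l) w := by
  intro z hlz hzl hmem
  obtain hz | hz := lt_or_ge z.val (2 * n - k)
  · exact hclear z hlz hz hmem
  have hyk : (bar z).val < k := by rw [val_bar]; omega
  have hly : l ≤ bar z := by rw [Fin.le_def, val_bar]; omega
  rw [← bar_bar z, signedPerm_bar] at hmem
  obtain heq | hlt := hly.eq_or_lt
  · rw [← heq] at hmem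
    exact hside.bar_notMem_circIoc (Or.inr hside) hmem
  · rw [h.matched _ hlt hyk] at hmem
    refine h.false_of_notMem_twinArcs hl hly hyk (hside.notMem_twinArcs hmem) fun x hkx hxn hx => ?_
    obtain hx | hx := hside.mem_circIoc_of_mem_twinArcs hmem hx
    · exact hclear x (hl.trans_le hkx) (by omega) hx
    · rw [← signedPerm_bar] at hx
      exact hclear _ (by rw [Fin.lt_def, val_bar]; omega) (by rw [val_bar]; omega) hx

end Rows

section Exchange

variable {n k : ℕ} {t w w' : signedPerm n} {l x y z : Letter n}

/-- `w'` arises from `w` by exchanging the values at `x` and `y`, and hence also those at `x̄` and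
`ȳ`. -/
structure Exchanged (w w' : signedPerm n) (x y : Letter n) : Prop where
  left : w'.val x = w.val y
  right : w'.val y = w.val x
  fixed : ∀ z, z ≠ x → z ≠ y → z ≠ bar x → z ≠ bar y → w'.val z = w.val z

theorem Exchanged.bar (h : Exchanged w w' x y) : Exchanged w w' (bar y) (bar x) where
  left := by rw [signedPerm_bar, h.right, signedPerm_bar]
  right := by rw [signedPerm_bar, h.left, signedPerm_bar]
  fixed z h₁ h₂ h₃ h₄ := by
    rw [bar_bar] at h₃ h₄
    exact h.fixed z h₄ h₃ h₂ h₁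

theorem Exchanged.apply_of_ne (h : Exchanged w w' x (TypeC.bar y)) (hy : y.val < n)
    (hx : x.val < n) (hz : z.val < n) (hzy : z ≠ y) (hzx : z ≠ x) : w'.val z = w.val z := by
  refine h.fixed z hzx ?_ ?_ (by rwa [bar_bar]) <;> rw [ne_eq, Fin.ext_iff, val_bar] <;> omega

theorem exchanged_of_reflPerm_eq {α : PosRoot n} (w : signedPerm n) (hxy : x ≠ bar y)
    (hα : α.reflPerm = Equiv.swap x y * Equiv.swap (bar y) (bar x)) :
    Exchanged w (w * α.refl) x y := by
  have bar_ne (z : Letter n) : z ≠ bar z := by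
    rw [ne_eq, Fin.ext_iff, val_bar]
    omega
  have hyx : y ≠ bar x := fun h => hxy (by rw [h, bar_bar])
  have hval (z : Letter n) : (w * α.refl).val z =
      w.val (Equiv.swap x y (Equiv.swap (bar y) (bar x) z)) :=
    congrArg w.val (DFunLike.congr_fun hα z)
  refine ⟨?_, ?_, fun z h₁ h₂ h₃ h₄ => ?_⟩
  · rw [hval, Equiv.swap_apply_of_ne_of_ne hxy (bar_ne x), Equiv.swap_apply_left]
  · rw [hval, Equiv.swap_apply_of_ne_of_ne (bar_ne y) hyx, Equiv.swap_apply_right]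
  · rw [hval, Equiv.swap_apply_of_ne_of_ne h₄ h₃, Equiv.swap_apply_of_ne_of_ne h₁ h₂]

theorem exchanged_sub (w : signedPerm n) (i j : Fin n) (h : i < j) :
    Exchanged w (w * (PosRoot.sub i j h).refl) (unbarred i) (unbarred j) :=
  exchanged_of_reflPerm_eq w (unbarred_lt_bar i j).ne rfl

theorem exchanged_add (w : signedPerm n) (i j : Fin n) (h : i < j) :
    Exchanged w (w * (PosRoot.add i j h).refl) (unbarred i) (bar (unbarred j)) := by
  refine exchanged_of_reflPerm_eq w ?_ ?_ <;> rw [bar_bar]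
  · exact (unbarred_lt_unbarred.2 h).ne
  · rfl

theorem exchanged_add_bar (w : signedPerm n) (i j : Fin n) (h : i < j) :
    Exchanged w (w * (PosRoot.add i j h).refl) (unbarred j) (bar (unbarred i)) := by
  simpa only [bar_bar] using (exchanged_add w i j h).bar

theorem mul_refl_dbl_self (w : signedPerm n) (i : Fin n) :
    (w * (PosRoot.dbl i).refl).val (unbarred i) = bar (w.val (unbarred i)) :=
  (congrArg w.val (Equiv.swap_apply_left _ _)).trans (signedPerm_bar w _)

theorem mul_refl_dbl_of_ne (w : signedPerm n) {i : Fin n} (hz : z ≠ unbarred i)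
    (hz' : z ≠ bar (unbarred i)) : (w * (PosRoot.dbl i).refl).val z = w.val z :=
  congrArg w.val (Equiv.swap_apply_of_ne_of_ne hz hz')

theorem clearBelow_exchange (hE : Exchanged w w' l y) (hly : l < y)
    (hmid : w.val y ∈ CircIoc (w.val l) (t.val l) → ∀ z, l < z → z < y → w'.val z ≠ w.val z →
      w.val z ∉ CircIoc (w.val l) (t.val l) ∧ w'.val z ∉ CircIoc (w.val y) (t.val l)) :
    ClearBetween w l y ∧ ClearBelow t l (y.val + 1) w' ↔
      ClearBelow t l y w ∧ w.val y ∈ CircIoc (w.val l) (t.val l) := by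
  rw [clearBelow_succ hly, hE.left, hE.right,
    ← mem_circIoc_iff_notMem (w.val.injective.ne hly.ne), ← and_assoc]
  refine and_congr_left fun hG => ?_
  rw [ClearBetween, ClearBelow, ClearBelow, hE.left, ← forall_and]
  refine forall_congr' fun z => ?_
  rw [← imp_and]
  refine imp_congr_right fun hlz => ?_
  rw [← Fin.lt_def, ← imp_and]
  refine imp_congr_right fun hzy => ?_
  have hne : w.val z ≠ w.val l := w.val.injective.ne hlz.ne'
  have harc : CircLE (w.val l) (w.val z) (w.val y) ↔ w.val z ∈ CircIoc (w.val l) (w.val y) :=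
    (and_iff_right hne).symm
  have hsplit := mem_circIoc_split (x := w.val z) hG
  by_cases heq : w'.val z = w.val z
  · rw [heq, harc, hsplit]
    tauto
  · have := hmid hG z hlz hzy heq
    tauto

theorem clearBelow_exchange_of_sameSide (hE : Exchanged w w' l y) (hly : l < y) :
    (SameSide (w.val l) (w.val y) ∧ ClearBetween w l y) ∧
        SameSide (w'.val l) (t.val l) ∧ ClearBelow t l (y.val + 1) w' ↔
      (SameSide (w.val l) (t.val l) ∧ ClearBelow t l y w) ∧
        w.val y ∈ CircIoc (w.val l) (t.val l) := by
  have hmid (hside : SameSide (w.val l) (t.val l))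
      (hG : w.val y ∈ CircIoc (w.val l) (t.val l)) (z : Letter n) (hlz : l < z) (hzy : z < y)
      (hz : w'.val z ≠ w.val z) :
      w.val z ∉ CircIoc (w.val l) (t.val l) ∧ w'.val z ∉ CircIoc (w.val y) (t.val l) := by
    obtain ⟨hly', hyt⟩ := hside.of_mem_circIoc hG
    obtain rfl | rfl : z = bar l ∨ z = bar y := by
      by_contra! hne
      exact hz (hE.fixed z hlz.ne' hzy.ne hne.1 hne.2)
    · rw [signedPerm_bar, signedPerm_bar, hE.left]
      exact ⟨hside.bar_notMem_circIoc (.inr hside), hyt.bar_notMem_circIoc (.inr hyt)⟩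
    · rw [signedPerm_bar, signedPerm_bar, hE.right]
      exact ⟨hside.bar_notMem_circIoc (.inl hly'), hyt.bar_notMem_circIoc (.inr hside)⟩
  rw [hE.left]
  constructor
  · rintro ⟨⟨hly', hbetween⟩, hyt, hclear⟩
    have hside := hly'.trans hyt
    obtain ⟨hclear', hG⟩ := (clearBelow_exchange hE hly (hmid hside)).1 ⟨hbetween, hclear⟩
    exact ⟨⟨hside, hclear'⟩, hG⟩
  · rintro ⟨⟨hside, hclear⟩, hG⟩
    obtain ⟨hly', hyt⟩ := hside.of_mem_circIoc hG
    obtain ⟨hbetween, hclear'⟩ := (clearBelow_exchange hE hly (hmid hside)).2 ⟨hclear, hG⟩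
    exact ⟨⟨hly', hbetween⟩, hyt, hclear'⟩

end Exchange

section ColumnExchange

variable {n k : ℕ} {t w w' : signedPerm n} {i l x z : Letter n}

/-- The relation between the two ends of a step labelled `(i, l̄)`, made while row `l` is being
processed. The condition on row `i` is left out, because this step affects it. -/
structure ColumnExchange (t : signedPerm n) (k : ℕ) (i l : Letter n) (w w' : signedPerm n) :
    Prop where
  exchanged : Exchanged w w' l (bar i)
  lt : i < l
  rows : ∀ x < l, x ≠ i → RowClear t k w x
  matched : ∀ z, l < z → z.val < k → w.val z = t.val z
  sameSide : SameSide (w.val l) (t.val l)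
  clear : ClearBelow t l (bar i) w
  mem : w.val (bar i) ∈ CircIoc (w.val l) (t.val l)

namespace ColumnExchange

theorem apply_mirror (h : ColumnExchange t k i l w w') :
    w.val i = bar (w.val (bar i)) ∧ w'.val i = bar (w.val l) := by
  rw [← h.exchanged.right, signedPerm_bar, signedPerm_bar, bar_bar, bar_bar]
  exact ⟨rfl, rfl⟩

theorem apply_of_ne (h : ColumnExchange t k i l w w') (hln : l.val < n) (hx : x.val < n)
    (hxi : x ≠ i) (hxl : x ≠ l) : w'.val x = w.val x :=
  h.exchanged.apply_of_ne (lt_trans h.lt hln) hln hx hxi hxl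

theorem notMem_of_lt (h : ColumnExchange t k i l w w') (hln : l.val < n) (hlx : l < x)
    (hx : x.val < n) : w.val x ∉ CircIoc (w.val l) (t.val l) :=
  h.clear x hlx (by rw [val_bar]; have := Fin.lt_def.1 h.lt; omega)

theorem bar_notMem_of_lt (h : ColumnExchange t k i l w w') (hln : l.val < n) (hix : i < x)
    (hx : x.val < n) : bar (w.val x) ∉ CircIoc (w.val l) (t.val l) := by
  rw [← signedPerm_bar]
  exact h.clear (bar x) (hln.trans_le (by rw [val_bar]; omega)) (bar_lt_bar.2 hix)

theorem mem_twinArcs_target (h : ColumnExchange t k i l w w') (hl : l.val < k) (hk : k ≤ n)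
    (hiz : i ≤ z) (hzl : z < l) (hz : bar (t.val z) ∈ CircIoc (w.val l) (t.val l)) (hxn : x.val < n)
    (hx : w'.val x ∈ twinArcs (t.val l) (t.val z)) : t.val x ∈ twinArcs (t.val l) (t.val z) := by
  have hln : l.val < n := hl.trans_le hk
  obtain rfl | hxl := eq_or_ne x l
  · exact left_mem_twinArcs
  obtain rfl | hxi := eq_or_ne x i
  · rw [h.apply_mirror.2, bar_mem_twinArcs] at hx
    exact absurd hx (h.sameSide.notMem_twinArcs hz)
  rw [h.apply_of_ne hln hxn hxi hxl] at hx
  obtain hxl | hlx := hxl.lt_or_gt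
  · obtain hxz | rfl | hzx := lt_trichotomy x z
    · exact mem_twinArcs_of_not_circLE (h.rows x hxl hxi l hxl hl)
        (h.rows x hxl hxi z hxz (lt_trans hzl hl)) hx
    · exact right_mem_twinArcs
    · refine hx.elim (fun hx => ?_) fun hx =>
        .inr (circLE_of_circLE_of_not_circLE hx (h.rows x hxl hxi l hxl hl))
      rw [← circLE_bar, bar_bar] at hx
      exact absurd (h.sameSide.mem_circIoc_of_circLE hz hx)
        (h.bar_notMem_of_lt hln (hiz.trans_lt hzx) hxn)
  · obtain hxk | - := lt_or_ge x.val k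
    · rwa [← h.matched x hlx hxk]
    · obtain hx | hx := h.sameSide.mem_circIoc_of_mem_twinArcs hz hx
      · exact absurd hx (h.notMem_of_lt hln hlx hxn)
      · exact absurd hx (h.bar_notMem_of_lt hln (h.lt.trans hlx) hxn)

-- Otherwise `t` maps more letters into `twinArcs (t l) (t z)` than `w'` does, as it gains `z`.
theorem bar_target_notMem (h : ColumnExchange t k i l w w') (hl : l.val < k) (hk : k ≤ n)
    (hiz : i ≤ z) (hzk : z.val < k) : bar (t.val z) ∉ CircIoc (w.val l) (w.val (bar i)) := by
  have hln : l.val < n := hl.trans_le hk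
  intro hmem
  have hz : bar (t.val z) ∈ CircIoc (w.val l) (t.val l) := (mem_circIoc_split h.mem).2 (.inl hmem)
  obtain hzl | rfl | hlz := lt_trichotomy z l
  · have harc := mem_twinArcs_of_forall (fun x hxn => h.mem_twinArcs_target hl hk hiz hzl hz hxn)
      right_mem_twinArcs
    obtain rfl | hiz := hiz.eq_or_lt
    · rw [h.apply_mirror.2, bar_mem_twinArcs] at harc
      exact h.sameSide.notMem_twinArcs hz harc
    · rw [h.apply_of_ne hln (lt_trans hzl hln) hiz.ne' hzl.ne] at harc
      obtain harc | harc := harc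
      · rw [← circLE_bar, bar_bar] at harc
        exact h.bar_notMem_of_lt hln hiz (lt_trans hzl hln)
          (h.sameSide.mem_circIoc_of_circLE hz harc)
      · exact h.rows z hzl hiz.ne' l hzl hl (h.sameSide.circLE_of_circLE hz harc)
  · exact h.sameSide.bar_notMem_circIoc (.inr (SameSide.refl _)) hz
  · rw [← h.matched z hlz hzk] at hz
    exact h.bar_notMem_of_lt hln (h.lt.trans hlz) (hzk.trans_le hk) hz

theorem rowClear_iff (h : ColumnExchange t k i l w w') (hl : l.val < k) (hk : k ≤ n) :
    RowClear t k w' i ↔ RowClear t k w i := by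
  have hik : i.val < k := lt_trans h.lt hl
  rw [RowClear, RowClear, h.apply_mirror.1, h.apply_mirror.2]
  refine forall_congr' fun z => imp_congr_right fun hiz => imp_congr_right fun hzk => not_congr ?_
  exact (circLE_bar_left_iff (h.bar_target_notMem hl hk hiz.le hzk)
    (h.bar_target_notMem hl hk le_rfl hik)).symm

theorem circLE_apply (h : ColumnExchange t k i l w w') (hl : l.val < k) (hk : k ≤ n) :
    CircLE (w.val i) (w'.val i) (t.val i) := by
  rw [h.apply_mirror.1, h.apply_mirror.2]
  exact circLE_bar_bar_of_notMem (h.bar_target_notMem hl hk le_rfl (lt_trans h.lt hl))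

end ColumnExchange

end ColumnExchange

section Moves

variable {n k : ℕ} {t w w' : signedPerm n} {l x y : Letter n}

/-- Every entry of the column `w[1,k]` moves to the corresponding entry of `w'[1,k]` without going
around the circle past its target in `t[1,k]`. -/
def MovesToward (t : signedPerm n) (k : ℕ) (w w' : signedPerm n) : Prop :=
  ∀ x : Letter n, x.val < k → CircLE (w.val x) (w'.val x) (t.val x)

theorem movesToward_of_eq_of_ne (h : ∀ x, x ≠ l → x.val < k → w'.val x = w.val x)
    (hmem : w'.val l ∈ CircIoc (w.val l) (t.val l)) : MovesToward t k w w' := by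
  intro x hx
  obtain rfl | hxl := eq_or_ne x l
  · exact hmem.2
  · rw [h x hxl hx]
    exact circLE_left _ _

theorem Exchanged.apply_of_lt (h : Exchanged w w' l y) (hl : l.val < k) (hk : k ≤ n)
    (hy : k ≤ y.val) (hy' : k ≤ (TypeC.bar y).val) (hxl : x ≠ l) (hx : x.val < k) :
    w'.val x = w.val x := by
  refine h.fixed x hxl ?_ ?_ ?_ <;> rw [ne_eq, Fin.ext_iff]
  · omega
  · rw [val_bar]
    omega
  · omega

theorem ColumnExchange.movesToward {i : Letter n} (h : ColumnExchange t k i l w w')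
    (hl : l.val < k) (hk : k ≤ n) : MovesToward t k w w' := by
  intro x hx
  obtain rfl | hxi := eq_or_ne x i
  · exact h.circLE_apply hl hk
  obtain rfl | hxl := eq_or_ne x l
  · rw [h.exchanged.left]
    exact h.mem.2
  · rw [h.apply_of_ne (hl.trans_le hk) (hx.trans_le hk) hxi hxl]
    exact circLE_left _ _

theorem activeRow_iff_of_lt {i : Letter n} (hi : i < l) :
    ActiveRow t k l w ↔ RowClear t k w i ∧ (∀ x < l, x ≠ i → RowClear t k w x) ∧
      ∀ z, l < z → z.val < k → w.val z = t.val z := by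
  refine ⟨fun h => ⟨h.rows i hi, fun x hx _ => h.rows x hx, h.matched⟩, ?_⟩
  rintro ⟨hclear, hrows, hmatched⟩
  refine ⟨fun x hx => ?_, hmatched⟩
  obtain rfl | hxi := eq_or_ne x i
  · exact hclear
  · exact hrows x hx hxi

theorem activeRow_exchange_bar_iff {i : Letter n} (hE : Exchanged w w' l (bar i)) (hi : i < l)
    (hl : l.val < k) (hk : k ≤ n) (hside : SameSide (w.val l) (t.val l))
    (hclear : ClearBelow t l (bar i) w) (hmem : w.val (bar i) ∈ CircIoc (w.val l) (t.val l)) :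
    ActiveRow t k l w' ↔ ActiveRow t k l w := by
  have hfixed (x : Letter n) (hx : x.val < k) (hxi : x ≠ i) (hxl : x ≠ l) :=
    hE.apply_of_ne (lt_trans hi (hl.trans_le hk)) (hl.trans_le hk) (hx.trans_le hk) hxi hxl
  have hothers : ((∀ x < l, x ≠ i → RowClear t k w' x) ∧
      ∀ z, l < z → z.val < k → w'.val z = t.val z) ↔
      (∀ x < l, x ≠ i → RowClear t k w x) ∧ ∀ z, l < z → z.val < k → w.val z = t.val z := by
    refine and_congr
      (forall_congr' fun x => imp_congr_right fun hx => imp_congr_right fun hxi => ?_)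
      (forall_congr' fun z => imp_congr_right fun hz => imp_congr_right fun hzk => ?_)
    · rw [RowClear, RowClear, hfixed x (lt_trans hx hl) hxi hx.ne]
    · rw [hfixed z hzk (lt_trans hi hz).ne' hz.ne']
  rw [activeRow_iff_of_lt hi, activeRow_iff_of_lt hi, hothers]
  refine and_congr_left fun ⟨hrows, hmatched⟩ => ?_
  exact ColumnExchange.rowClear_iff ⟨hE, hi, hrows, hmatched, hside, hclear, hmem⟩ hl hk

theorem clearBetween_bar_self_iff :
    ClearBetween w l (bar l) ↔
      ∀ z, l < z → z.val < n → ¬ CircLE (w.val l) (w.val z) (bar (w.val l)) := by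
  rw [ClearBetween, signedPerm_bar]
  refine ⟨fun h z hlz hzn => h z hlz ?_, fun h z hlz hzl => ?_⟩
  · rw [Fin.lt_def, val_bar]
    have := Fin.lt_def.1 hlz
    omega
  · obtain hzn | hnz := lt_or_ge z.val n
    · exact h z hlz hzn
    · have hbar := h (bar z) (by rwa [← bar_lt_bar, bar_bar]) (by rw [val_bar]; omega)
      rwa [signedPerm_bar, ← circLE_bar, bar_bar, bar_bar] at hbar

theorem clearBetween_bar_and_clearBelow_iff (hleft : w'.val l = bar (w.val l))
    (hfixed : ∀ z, l < z → z.val < n → w'.val z = w.val z)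
    (hmem : bar (w.val l) ∈ CircIoc (w.val l) (t.val l)) :
    ClearBetween w l (bar l) ∧ ClearBelow t l n w' ↔ ClearBelow t l n w := by
  rw [clearBetween_bar_self_iff, ClearBelow, ClearBelow, hleft, ← forall_and]
  refine forall_congr' fun z => ?_
  rw [← imp_and]
  refine imp_congr_right fun hlz => ?_
  rw [← imp_and]
  refine imp_congr_right fun hzn => ?_
  have harc : CircLE (w.val l) (w.val z) (bar (w.val l)) ↔
      w.val z ∈ CircIoc (w.val l) (bar (w.val l)) :=
    (and_iff_right (w.val.injective.ne hlz.ne')).symm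
  rw [hfixed z hlz hzn, harc, mem_circIoc_split hmem, not_or]

end Moves

section Steps

variable {n k : ℕ} (t : signedPerm n) {i j l : Fin n}

theorem pathTriple_sub (hk : k ≤ n) (hi : i.val < k) (hj : k ≤ j.val) (hij : i < j) :
    PathTriple (MovesToward t k)
      (fun w => ActiveRow t k (unbarred i) w ∧ ClearBelow t (unbarred i) j w)
      [.sub i j hij]
      (fun w => ActiveRow t k (unbarred i) w ∧ ClearBelow t (unbarred i) (j + 1) w) := by
  have hlt : unbarred i < unbarred j := unbarred_lt_unbarred.2 hij
  have hE (w : signedPerm n) := exchanged_sub w i j hij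
  have hfixed (w : signedPerm n) (x : Letter n) (hx : x ≠ unbarred i) (hxk : x.val < k) :=
    (hE w).apply_of_lt (k := k) hi hk hj (by rw [val_bar, val_unbarred]; omega) hx hxk
  refine PathTriple.single _
    (G := fun w => w.val (unbarred j) ∈ CircIoc (w.val (unbarred i)) (t.val (unbarred i)))
    (fun w => ?_) (fun w => ?_) fun w _ hG => ?_
  · rw [and_assoc]
    exact and_congr_right fun _ => clearBelow_succ hlt
  · rw [qbEdge_sub_iff, activeRow_congr (hfixed w) hi, and_left_comm, and_assoc]
    refine and_congr_right fun _ => clearBelow_exchange (hE w) hlt fun _ z hiz hzj hne => ?_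
    refine absurd ((hE w).fixed z hiz.ne' hzj.ne ?_ ?_) hne
    · exact (hzj.trans (unbarred_lt_bar j i)).ne
    · exact (hzj.trans (unbarred_lt_bar j j)).ne
  · refine movesToward_of_eq_of_ne (hfixed w) ?_
    rwa [(hE w).left]

theorem pathTriple_dbl (hk : k ≤ n) (hi : i.val < k) :
    PathTriple (MovesToward t k)
      (fun w => ActiveRow t k (unbarred i) w ∧ ClearBelow t (unbarred i) n w)
      [.dbl i]
      (fun w => ActiveRow t k (unbarred i) w ∧
        SameSide (w.val (unbarred i)) (t.val (unbarred i)) ∧ ClearBelow t (unbarred i) n w) := by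
  have hfixed (w : signedPerm n) (x : Letter n) (hx : x ≠ unbarred i) (hxn : x.val < n) :
      (w * (PosRoot.dbl i).refl).val x = w.val x := by
    refine mul_refl_dbl_of_ne w hx ?_
    rw [ne_eq, Fin.ext_iff, val_bar, val_unbarred]
    omega
  have hfixed' (w : signedPerm n) (x : Letter n) (hx : x ≠ unbarred i) (hxk : x.val < k) :=
    hfixed w x hx (hxk.trans_le hk)
  refine PathTriple.single _
    (G := fun w => bar (w.val (unbarred i)) ∈ CircIoc (w.val (unbarred i)) (t.val (unbarred i)))
    (fun w => ?_) (fun w => ?_) fun w _ hG => ?_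
  · rw [and_comm (a := SameSide _ _), ← and_assoc]
    exact and_congr_right fun h => h.1.sameSide_iff hi h.2
  · have hactive := activeRow_congr (t := t) (hfixed' w) hi
    have hside (h : ActiveRow t k (unbarred i) (w * (PosRoot.dbl i).refl))
        (hclear : ClearBelow t (unbarred i) n (w * (PosRoot.dbl i).refl)) :
        SameSide ((w * (PosRoot.dbl i).refl).val (unbarred i)) (t.val (unbarred i)) ↔
          bar (w.val (unbarred i)) ∈ CircIoc (w.val (unbarred i)) (t.val (unbarred i)) := by
      rw [h.sameSide_iff hi hclear, mul_refl_dbl_self, bar_bar,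
        mem_circIoc_iff_notMem (a := w.val (unbarred i))]
      rw [ne_eq, Fin.ext_iff, val_bar]
      omega
    have hclear := clearBetween_bar_and_clearBelow_iff (t := t) (mul_refl_dbl_self w i)
      fun z hz hzn => hfixed w z hz.ne' hzn
    rw [qbEdge_dbl_iff]
    tauto
  · refine movesToward_of_eq_of_ne (hfixed' w) ?_
    rwa [mul_refl_dbl_self]

theorem pathTriple_add (hk : k ≤ n) (hi : i.val < k) (hj : k ≤ j.val) (hij : i < j) :
    PathTriple (MovesToward t k)
      (fun w => ActiveRow t k (unbarred i) w ∧
        SameSide (w.val (unbarred i)) (t.val (unbarred i)) ∧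
          ClearBelow t (unbarred i) (bar (unbarred j)) w)
      [.add i j hij]
      (fun w => ActiveRow t k (unbarred i) w ∧
        SameSide (w.val (unbarred i)) (t.val (unbarred i)) ∧
          ClearBelow t (unbarred i) ((bar (unbarred j)).val + 1) w) := by
  have hlt := unbarred_lt_bar i j
  have hE (w : signedPerm n) := exchanged_add w i j hij
  have hfixed (w : signedPerm n) (x : Letter n) (hx : x ≠ unbarred i) (hxk : x.val < k) :=
    (hE w).apply_of_lt (k := k) hi hk (by rw [val_bar, val_unbarred]; omega)
      (by rwa [bar_bar]) hx hxk
  refine PathTriple.single _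
    (G := fun w => w.val (bar (unbarred j)) ∈ CircIoc (w.val (unbarred i)) (t.val (unbarred i)))
    (fun w => ?_) (fun w => ?_) fun w _ hG => ?_
  · rw [clearBelow_succ hlt, and_assoc, and_assoc]
  · rw [qbEdge_add_iff, activeRow_congr (hfixed w) hi, and_left_comm, and_assoc (a := ActiveRow ..)]
    exact and_congr_right fun _ => clearBelow_exchange_of_sameSide (hE w) hlt
  · refine movesToward_of_eq_of_ne (hfixed w) ?_
    rwa [(hE w).left]

theorem pathTriple_add_bar (hk : k ≤ n) (hl : l.val < k) (hil : i < l) :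
    PathTriple (MovesToward t k)
      (fun w => ActiveRow t k (unbarred l) w ∧
        SameSide (w.val (unbarred l)) (t.val (unbarred l)) ∧
          ClearBelow t (unbarred l) (bar (unbarred i)) w)
      [.add i l hil]
      (fun w => ActiveRow t k (unbarred l) w ∧
        SameSide (w.val (unbarred l)) (t.val (unbarred l)) ∧
          ClearBelow t (unbarred l) ((bar (unbarred i)).val + 1) w) := by
  have hlt := unbarred_lt_bar l i
  have hE (w : signedPerm n) := exchanged_add_bar w i l hil
  refine PathTriple.single _
    (G := fun w => w.val (bar (unbarred i)) ∈ CircIoc (w.val (unbarred l)) (t.val (unbarred l)))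
    (fun w => ?_) (fun w => ?_) ?_
  · rw [clearBelow_succ hlt, and_assoc, and_assoc]
  · rw [qbEdge_add_iff_bar, and_left_comm, clearBelow_exchange_of_sameSide (hE w) hlt,
      and_assoc (a := ActiveRow ..)]
    exact and_congr_left fun h => activeRow_exchange_bar_iff (hE w) hil hl hk h.1.1 h.1.2 h.2
  · rintro w ⟨hactive, hside, hclear⟩ hG
    exact ColumnExchange.movesToward ⟨hE w, hil, fun x hx _ => hactive.rows x hx,
      hactive.matched, hside, hclear, hG⟩ hl hk

end Steps

section Assembly

variable {n k : ℕ} (t : signedPerm n)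

theorem gammaSegment_reverse (hk : k ≤ n) (i : Fin k) :
    (gammaSegment hk i).reverse =
      ((List.finRange n).filterMap fun j =>
        if h : k ≤ j.val then
          some (.sub (Fin.castLE hk i) j (Fin.lt_def.2 (lt_of_lt_of_le i.isLt h)))
        else none) ++
      ([.dbl (Fin.castLE hk i)] ++
      (((List.finRange n).reverse.filterMap fun j =>
        if h : k ≤ j.val then
          some (.add (Fin.castLE hk i) j (Fin.lt_def.2 (lt_of_lt_of_le i.isLt h)))
        else none) ++
      ((List.finRange n).reverse.filterMap fun j =>
        if h : j < Fin.castLE hk i then some (.add j (Fin.castLE hk i) h) else none))) := by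
  simp only [gammaSegment, List.reverse_append, List.filterMap_reverse, List.reverse_reverse,
    List.reverse_singleton]

theorem pathTriple_subs (hk : k ≤ n) (i : Fin n) (hi : i.val < k) :
    PathTriple (MovesToward t k)
      (fun w => ActiveRow t k (unbarred i) w ∧ ClearBelow t (unbarred i) k w)
      ((List.finRange n).filterMap fun j =>
        if h : k ≤ j.val then some (.sub i j (Fin.lt_def.2 (hi.trans_le h))) else none)
      (fun w => ActiveRow t k (unbarred i) w ∧ ClearBelow t (unbarred i) n w) := by
  have chain := PathTriple.filterMap_finRange (R := MovesToward t k) n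
    (fun j => k ≤ j.val) (fun j hj => .sub i j (Fin.lt_def.2 (hi.trans_le hj)))
    (fun j w => ActiveRow t k (unbarred i) w ∧ ClearBelow t (unbarred i) (max j k) w)
    (fun j hj => ?_) fun j hj => ?_
  · simpa only [Nat.zero_max, max_eq_left hk] using chain
  · simpa only [max_eq_left hj, max_eq_left (Nat.le_succ_of_le hj)] using
      pathTriple_sub t hk hi hj (Fin.lt_def.2 (hi.trans_le hj))
  · rw [max_eq_right (not_le.1 hj).le, max_eq_right (not_le.1 hj)]

theorem pathTriple_adds (hk : k ≤ n) (i : Fin n) (hi : i.val < k) :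
    PathTriple (MovesToward t k)
      (fun w => ActiveRow t k (unbarred i) w ∧
        SameSide (w.val (unbarred i)) (t.val (unbarred i)) ∧ ClearBelow t (unbarred i) n w)
      ((List.finRange n).reverse.filterMap fun j =>
        if h : k ≤ j.val then some (.add i j (Fin.lt_def.2 (hi.trans_le h))) else none)
      (fun w => ActiveRow t k (unbarred i) w ∧
        SameSide (w.val (unbarred i)) (t.val (unbarred i)) ∧
          ClearBelow t (unbarred i) (2 * n - i) w) := by
  have chain := PathTriple.filterMap_finRange_reverse (R := MovesToward t k) n
    (fun j => k ≤ j.val) (fun j hj => .add i j (Fin.lt_def.2 (hi.trans_le hj)))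
    (fun j w => ActiveRow t k (unbarred i) w ∧
      SameSide (w.val (unbarred i)) (t.val (unbarred i)) ∧
        ClearBelow t (unbarred i) (2 * n - max j k) w)
    (fun j hj => ?_) fun j hj => ?_
  · have hstart : 2 * n - max n k = n := by omega
    simp only [hstart, Nat.zero_max] at chain
    refine chain.congr (fun w => Iff.rfl) fun w => and_congr_right fun h => and_congr_right
      fun hside => ⟨h.clearBelow_mirror hi hk hside, fun hclear z hz hzk => hclear z hz ?_⟩
    omega
  · have hpos : 2 * n - max (j.val + 1) k = (bar (unbarred j)).val := by
      rw [val_bar, val_unbarred]; omega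
    have hpos' : 2 * n - max j.val k = (bar (unbarred j)).val + 1 := by
      rw [val_bar, val_unbarred]; omega
    simpa only [hpos, hpos'] using pathTriple_add t hk hi hj (Fin.lt_def.2 (hi.trans_le hj))
  · rw [max_eq_right (not_le.1 hj).le, max_eq_right (not_le.1 hj)]

theorem pathTriple_add_bars (hk : k ≤ n) (l : Fin n) (hl : l.val < k) :
    PathTriple (MovesToward t k)
      (fun w => ActiveRow t k (unbarred l) w ∧
        SameSide (w.val (unbarred l)) (t.val (unbarred l)) ∧
          ClearBelow t (unbarred l) (2 * n - l) w)
      ((List.finRange n).reverse.filterMap fun i =>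
        if h : i < l then some (.add i l h) else none)
      (fun w => ActiveRow t k (unbarred l) w ∧
        SameSide (w.val (unbarred l)) (t.val (unbarred l)) ∧
          ClearBelow t (unbarred l) (2 * n) w) := by
  have chain := PathTriple.filterMap_finRange_reverse (R := MovesToward t k) n
    (fun i => i < l) (fun i hi => .add i l hi)
    (fun i w => ActiveRow t k (unbarred l) w ∧
      SameSide (w.val (unbarred l)) (t.val (unbarred l)) ∧
        ClearBelow t (unbarred l) (2 * n - min i l) w)
    (fun i hi => ?_) fun i hi => ?_
  · simpa only [Nat.zero_min, Nat.sub_zero, min_eq_right l.isLt.le] using chain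
  · have := Fin.lt_def.1 hi
    have hpos : 2 * n - min (i.val + 1) l = (bar (unbarred i)).val := by
      rw [val_bar, val_unbarred]; omega
    have hpos' : 2 * n - min i.val l = (bar (unbarred i)).val + 1 := by
      rw [val_bar, val_unbarred]; omega
    simpa only [hpos, hpos'] using pathTriple_add_bar t hk hl hi
  · have hval := Fin.le_def.1 (not_lt.1 hi)
    rw [min_eq_right hval, min_eq_right (Nat.le_succ_of_le hval)]

theorem pathTriple_gammaSegment (hk : k ≤ n) (i : Fin k) :
    PathTriple (MovesToward t k) (MatchedFrom t k (i + 1)) (gammaSegment hk i).reverse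
      (MatchedFrom t k i) := by
  have row := (pathTriple_subs t hk (Fin.castLE hk i) i.isLt).append <|
    (pathTriple_dbl t hk i.isLt).append <|
      (pathTriple_adds t hk (Fin.castLE hk i) i.isLt).append <|
        pathTriple_add_bars t hk (Fin.castLE hk i) i.isLt
  rw [gammaSegment_reverse]
  exact row.congr (fun w => (matchedFrom_succ_iff (l := unbarred (Fin.castLE hk i)) i.isLt).symm)
    fun w => (matchedFrom_iff (l := unbarred (Fin.castLE hk i)) i.isLt).symm

theorem pathTriple_gammaL (hk : k ≤ n) :
    PathTriple (MovesToward t k) (MatchedFrom t k k) (gammaL hk).reverse (MatchedFrom t k 0) := by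
  rw [gammaL, List.reverse_flatMap]
  exact PathTriple.flatMap_finRange_reverse k _ (MatchedFrom t k) (pathTriple_gammaSegment t hk)

end Assembly

section Target

variable {n k : ℕ}

theorem absIndex_unbarred (i : Fin n) : absIndex (unbarred i) = i := by
  simp only [Fin.ext_iff, absIndex, val_bar, val_unbarred]
  omega

theorem eq_or_eq_bar_of_absIndex_eq {x y : Letter n} (h : absIndex x = absIndex y) :
    x = y ∨ x = bar y := by
  simp only [absIndex, Fin.ext_iff, val_bar] at *
  omega

theorem absIndex_bar (x : Letter n) : absIndex (bar x) = absIndex x := by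
  simp only [absIndex, bar_bar, min_comm]

theorem exists_signedPerm_of_injective {f : Fin n → Letter n}
    (hf : Function.Injective fun i => absIndex (f i)) :
    ∃ t : signedPerm n, ∀ i, t.val (unbarred i) = f i := by
  let g (x : Letter n) : Letter n := if x.val < n then f (absIndex x) else bar (f (absIndex x))
  have absIndex_g (x : Letter n) : absIndex (g x) = absIndex (f (absIndex x)) := by
    dsimp only [g]
    split_ifs
    · rfl
    · rw [absIndex_bar]
  have g_bar (x : Letter n) : g (bar x) = bar (g x) := by
    have hx : (bar x).val < n ↔ ¬ x.val < n := by
      rw [val_bar]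
      omega
    simp only [g, hx, absIndex_bar]
    split_ifs
    · rfl
    · rw [bar_bar]
  have g_injective : Function.Injective g := by
    intro x y hxy
    have habs : absIndex x = absIndex y := by
      have := congrArg absIndex hxy
      rw [absIndex_g, absIndex_g] at this
      exact hf this
    obtain rfl | rfl := eq_or_eq_bar_of_absIndex_eq habs
    · rfl
    · have hne : bar (g y) ≠ g y := by
        rw [ne_eq, Fin.ext_iff, val_bar]
        omega
      exact absurd ((g_bar y).symm.trans hxy) hne
  refine ⟨⟨Equiv.ofBijective g (Finite.injective_iff_bijective.1 g_injective), g_bar⟩, fun i => ?_⟩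
  change g (unbarred i) = f i
  simp only [g, absIndex_unbarred, val_unbarred, i.isLt, if_true]

theorem IsColumn.exists_initialColumn_eq {C : Fin k → Letter n} (hC : IsColumn C) (hk : k ≤ n) :
    ∃ t : signedPerm n, initialColumn hk t = C := by
  obtain ⟨σ, hσ⟩ := Equiv.Perm.exists_extending_pair (Fin.castLE hk) (fun i => absIndex (C i))
    (Fin.castLE_injective hk) hC
  let f (x : Fin n) : Letter n := if hx : x.val < k then C ⟨x, hx⟩ else unbarred (σ x)
  have absIndex_f (x : Fin n) : absIndex (f x) = σ x := by
    dsimp only [f]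
    split_ifs with hx
    · exact (hσ ⟨x, hx⟩).symm
    · exact absIndex_unbarred _
  obtain ⟨t, ht⟩ := exists_signedPerm_of_injective (f := f) (by
    simpa only [absIndex_f] using σ.injective)
  exact ⟨t, funext fun i => (ht _).trans (dif_pos i.isLt)⟩

theorem not_eq_and_not_circLT_iff {a x y : Letter n} (h : x ≠ y) :
    ¬ a = x ∧ ¬ (CircLT a a x ∧ CircLT a x y) ↔ ¬ CircLE a x y := by
  have circLT_iff (b c : Letter n) : CircLT a b c ↔ ¬ CircLE a c b := not_le.symm
  simp only [circLT_iff, circLE_iff, Fin.le_def, Fin.lt_def, Fin.ext_iff, ne_eq] at *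
  omega

theorem columnCondition_iff_matchedFrom (hk : k ≤ n) (t u : signedPerm n) :
    ColumnCondition (initialColumn hk t) (initialColumn hk u) ↔ MatchedFrom t k k u := by
  have entry_ne {i j : Fin k} (hij : i < j) : initialColumn hk t j ≠ initialColumn hk t i :=
    t.val.injective.ne (unbarred_lt_unbarred.2 (Fin.castLE_lt_castLE_iff hk |>.2 hij)).ne'
  constructor
  · intro h
    refine ⟨fun x hx z hxz hzk => ?_, fun z hkz hzk => absurd hzk hkz.not_gt⟩
    have hij : (⟨x, hx⟩ : Fin k) < ⟨z, hzk⟩ := hxz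
    exact (not_eq_and_not_circLT_iff (entry_ne hij)).1 (h _ _ hij)
  · intro h i j hij
    exact (not_eq_and_not_circLT_iff (entry_ne hij)).2
      (h.rows (unbarred (Fin.castLE hk i)) i.isLt (unbarred (Fin.castLE hk j)) hij j.isLt)

theorem initialColumn_eq_iff_matchedFrom (hk : k ≤ n) (t v : signedPerm n) :
    initialColumn hk v = initialColumn hk t ↔ MatchedFrom t k 0 v := by
  refine ⟨fun h => ⟨fun x hx => absurd hx x.val.not_lt_zero, fun z _ hz => ?_⟩, fun h => ?_⟩
  · exact congrFun h ⟨z, hz⟩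
  · exact funext fun i => h.matched (unbarred (Fin.castLE hk i)) (Nat.zero_le _) i.isLt

theorem circLE_and_circLE_of_circLE {a x y z : Letter n} (hx : CircLE a x z) (hy : CircLE x y z) :
    CircLE a x y ∧ CircLE a y z := by
  simp only [circLE_iff, Fin.le_def, Fin.lt_def] at *
  omega

theorem isChain_circLE_initialColumn (hk : k ≤ n) {t w : signedPerm n} {L : List (signedPerm n)}
    {a : Letter n} {i : Fin k} (h : (w :: L).IsChain (MovesToward t k))
    (ha : CircLE a (initialColumn hk w i) (initialColumn hk t i)) :
    ((w :: L).map fun w => initialColumn hk w i).IsChain (CircLE a) := by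
  induction L generalizing w with
  | nil => exact List.isChain_singleton _
  | cons x L ih =>
    obtain ⟨hmove, hL⟩ := List.isChain_cons_cons.1 h
    obtain ⟨hwx, hxt⟩ := circLE_and_circLE_of_circLE ha (hmove (unbarred (Fin.castLE hk i)) i.isLt)
    exact List.isChain_cons_cons.2 ⟨hwx, ih hL hxt⟩

end Target

end TypeC

theorem mainTheorem8 (n k : ℕ) (hk1 : 1 ≤ k) (hk : k ≤ n) (u : TypeC.signedPerm n)
    (C' : Fin k → TypeC.Letter n) (hC' : TypeC.IsColumn C') :
    (TypeC.ColumnCondition C' (TypeC.initialColumn hk u) ↔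
      ∃ v S, TypeC.IsPathToColumn hk u C' v S) ∧
    (∀ v S v₂ S₂, TypeC.IsPathToColumn hk u C' v S → TypeC.IsPathToColumn hk u C' v₂ S₂ →
      v = v₂ ∧ S = S₂) ∧
    (∀ v S, TypeC.IsPathToColumn hk u C' v S → ∀ i : Fin k,
      List.IsChain (TypeC.CircLE (TypeC.initialColumn hk u i))
        ((TypeC.pathVertices u S).map fun w => TypeC.initialColumn hk w i)) := by
  obtain ⟨t, rfl⟩ := hC'.exists_initialColumn_eq hk
  have triple := TypeC.pathTriple_gammaL t hk
  rw [TypeC.columnCondition_iff_matchedFrom hk]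
  simp only [TypeC.IsPathToColumn, TypeC.initialColumn_eq_iff_matchedFrom hk]
  refine ⟨⟨fun hmatch => ?_, ?_⟩, ?_, ?_⟩
  · obtain ⟨S, v, hpath, hlabels, hend⟩ := triple.exists_path u hmatch
    exact ⟨v, S, hpath, hend, hlabels⟩
  · rintro ⟨v, S, hpath, hend, hlabels⟩
    exact (triple.source u S v hpath hlabels hend).1
  · rintro v S v₂ S₂ ⟨hpath, hend, hlabels⟩ ⟨hpath₂, hend₂, hlabels₂⟩
    obtain rfl := triple.unique u S v S₂ v₂ hpath hlabels hend hpath₂ hlabels₂ hend₂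
    exact ⟨hpath.end_unique hpath₂, rfl⟩
  · rintro v S ⟨hpath, hend, hlabels⟩ i
    exact TypeC.isChain_circLE_initialColumn hk (triple.source u S v hpath hlabels hend).2
      (TypeC.circLE_left _ _)
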